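/- **Setting.** Let $p\ge 1$, let $Y\in\mathbb R^{n\times p}$ have rows $y_1,\dots,y_n$ and put $S=Y^TY$. Let $\mathcal M_+(p)$ be the set of $p\times p$ real symmetric positive definite matrices, and let $\theta\in(0,1)$, $g>0$, $\lambda>0$, $\bar d\in\mathbb N$. For a graph $Z=(Z_{ik})_{i<k}\in\{0,1\}^{p(p-1)/2}$ with maximal node degree $d(Z)$, let $$\pi(\Omega\mid Z)=C_1(Z)\prod_i \mathrm{Exp}(\Omega_{ii};\lambda/2)\prod_{i<k,\,Z_{ik}=1}N(\Omega_{ik};0,g^2)\prod_{i<k,\,Z_{ik}=0}\delta_0(\Omega_{ik})\,\mathbf 1_{\Omega\in\mathcal M_+(p)},$$ $$\pi(Z)\propto C_1(Z)^{-1}\prod_{i<k}\theta^{Z_{ik}}(1-\theta)^{1-Z_{ik}}\,\mathbf 1_{d(Z)\le\bar d},$$ and let $\pi(\cdot\mid Y)$ be the posterior law of $\Omega$ under this prior and the likelihood $y_i\sim N(0,\Omega^{-1})$, independently for $i=1,\dots,n$. For $j\in[p]$ let $\Omega_{-j-j}$ be $\Omega$ without row and column $j$, and let $z\subseteq[p]\setminus\{j\}$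 denote the set of $k$ with $\Omega_{kj}\ne0$. Let $\pi(z\mid Y,\Omega_{-j-j})$ and $\pi(\Omega_{\cdot j}\mid z,Y,\Omega_{-j-j})$ be the conditional posteriors; in particular $\pi(z\mid Y,\Omega_{-j-j})=0$ when $z$ violates the constraint $d(Z)\le\bar d$. **Kernels.** $P^j_{Gibbs}$ keeps $\Omega_{-j-j}$ and draws $\Omega_{\cdot j}$ from $\pi(\Omega_{\cdot j}\mid Y,\Omega_{-j-j})$. For a proposal $Q=Q^j(z'\mid z)$, which may depend on $\Omega_{-j-j}$ and $Y$, let $$K(z,z')=b(z,z')\,Q(z'\mid z)+\mathbf 1_{z=z'}\Big(1-\sum_{z''}b(z,z'')\,Q(z''\mid z)\Big),\qquad b(z,z')=1\wedge\frac{\pi(z'\mid Y,\Omega_{-j-j})\,Q(z\mid z')}{\pi(z\mid Y,\Omega_{-j-j})\,Q(z'\mid z)} .$$ For a number $M\ge1$ of updates let $\tilde P^{j,\Omega_{-j-j}}_{MH}=K^M$, a kernel on the sets $z$. The kernel $\tilde P^j_{MH}$ keeps $\Omega_{-j-j}$, moves $z$ to $z'$ by $\tilde P^{j,\Omega_{-j-j}}_{MH}$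 and draws $\Omega_{\cdot j}$ from $\pi(\Omega_{\cdot j}\mid z',Y,\Omega_{-j-j})$. Put $$P^L_{Gibbs}=\tfrac12 I+\tfrac1{2p}\sum_{j=1}^pP^j_{Gibbs},\qquad P^L_{MH}=\tfrac12 I+\tfrac1{2p}\sum_{j=1}^p\tilde P^j_{MH}.$$ **Proposals.** The proposal $Q$ is one of the following. In BDMH and LIT, $p_{birth},p_{death}\in(0,1)$ with $p_{birth}+p_{death}\le1$ and $p_{swap}=1-p_{birth}-p_{death}$. Birth, death and swap moves from $z$ add one node, remove one node, or replace a node of $z$ by a node outside $z\cup\{j\}$. If a type of move is not available at $z$, its probability is not reassigned to other moves and the chain stays at $z$. * BDMH: $Q(z'\mid z)$ equals $\frac{p_{birth}}{p-1-|z|}$, $\frac{p_{death}}{|z|}$ or $\frac{p_{swap}}{|z|(p-1-|z|)}$ if $z'$ arises from $z$ by a birth, a death or a swap, and $0$ otherwise. * LIT: $Q(z'\mid z)=p_m\,w_m(z'\mid z)/\sum_{z''}w_m(z''\mid z)$ if $z'$ arises from $z$ by a move of type $m\in\{birth,death,swap\}$, where the sum is over all $z''$ that arise from $z$ by a move of type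 $m$, $w_m(z'\mid z)=\max\{a_m,\min\{\pi(z'\mid Y,\Omega_{-j-j})/\pi(z\mid Y,\Omega_{-j-j}),\,b_m\}\}$ and $0\le a_m\le b_m$; $Q(z'\mid z)=0$ for all other $z'$. * GIMH: $Q(z'\mid z)\propto\pi^{LR}_j(z'\mid Y)^\upsilon$ with $0<\upsilon\le1$, where $$\pi_j^{LR}(z\mid Y)\propto\frac{\theta^{|z|}(1-\theta)^{p-1-|z|}}{g^{|z|}|W_z|^{1/2}}\big(\lambda+S_{jj}-S_{zj}^TW_z^{-1}S_{zj}\big)^{-(n/2+1)}\mathbf 1_{|z|\le\bar d},\qquad W_z=S_{zz}+g^{-2}I .$$ **Notions.** For a kernel $P$ with invariant law $\pi$, the $s$-conductance is $\phi_s(P)=\inf\{\int_AP(x,A^c)\,\pi(dx)/\pi(A): s<\pi(A)<1/2\}$; here $\pi=\pi(\cdot\mid Y)$. The spectral gap is $\mathrm{Gap}(P)=\inf\{E(f,f)/\mathrm{Var}_\pi(f): f\in L_2(\pi),\ \mathrm{Var}_\pi(f)>0\}$ with $E(f,f)=\frac12\int(f(y)-f(x))^2\pi(dx)P(x,dy)$,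 and it is set to $1$ if no $f$ has $\mathrm{Var}_\pi(f)>0$. For $\tilde P^{j,\Omega_{-j-j}}_{MH}$ the invariant law is $\pi(z\mid Y,\Omega_{-j-j})$. **Proposition.** For each of the algorithms BDMH, GIMH and LIT, for all $M\ge1$, $B\subset\mathcal M_+(p)$ and $s>0$, $$\phi_s(P^L_{MH})\ \ge\ \frac12\,\phi_s(P^L_{Gibbs})\,\min_{j\in[p]}\inf_{\Omega\in B}\mathrm{Gap}\big(\tilde P^{j,\Omega_{-j-j}}_{MH}\big)-\frac{\pi(B^c\mid Y)}{s}.$$ (An infimum over an empty set, which occurs only if $B=\emptyset$ or $s\ge1/2$, is read as $0$.) -/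

import Mathlib

open MeasureTheory ProbabilityTheory
open scoped ENNReal

noncomputable section

namespace GGM

/-! ### Generalities on transition functions, conductance and spectral gaps -/

section General

variable {α : Type*} [MeasurableSpace α]

/-- The probability measure proportional to `μ`. -/
def normalize (μ : Measure α) : Measure α := (μ Set.univ)⁻¹ • μ

/-- The `s`-conductance of a transition function `P` with invariant law `π`:
the infimum over measurable `S` with `s < π(S) < 1/2` of `(∫_S P(x, Sᶜ) π(dx)) / π(S)`. -/
def sConductance (π : Measure α) (P : α → Measure α) (s : ℝ) : ℝ :=
  sInf {r : ℝ | ∃ S : Set α, MeasurableSet S ∧ s < π.real S ∧ π.real S < 1 / 2 ∧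
    r = (∫⁻ x in S, P x Sᶜ ∂π).toReal / π.real S}

end General

section FiniteChains

variable {ι : Type*} [Fintype ι]

/-- `Var_π(f) = E_π(f²) - E_π(f)²` for a probability vector `π`. -/
def variance (π : ι → ℝ) (f : ι → ℝ) : ℝ :=
  ∑ x, π x * f x ^ 2 - (∑ x, π x * f x) ^ 2

/-- `E(f,f) = 1/2 ∑ₓ ∑_y (f(y) - f(x))² π(x) K(x,y)`. -/
def dirichletForm (π : ι → ℝ) (K : Matrix ι ι ℝ) (f : ι → ℝ) : ℝ :=
  1 / 2 * ∑ x, ∑ y, (f y - f x) ^ 2 * (π x * K x y)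

open Classical in
/-- The spectral gap `inf {E(f,f) / Var_π(f) : Var_π(f) > 0}`. If `Var_π(f) = 0` for every `f`
(so that one step of the chain is already an independent draw from `π`), the gap is `1`. -/
def spectralGap (π : ι → ℝ) (K : Matrix ι ι ℝ) : ℝ :=
  if ∃ f : ι → ℝ, 0 < variance π f then
    sInf {r : ℝ | ∃ f : ι → ℝ, 0 < variance π f ∧ r = dirichletForm π K f / variance π f}
  else 1

/-- Metropolis-Hastings acceptance probability; `Q x y` is the probability `Q(y | x)` of
proposing `y` from `x`. -/
def acceptProb (π : ι → ℝ) (Q : Matrix ι ι ℝ) (x y : ι) : ℝ :=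
  min 1 (π y * Q y x / (π x * Q x y))

/-- Metropolis-Hastings kernel with target `π` and proposal `Q`. Proposal mass that `Q(· | x)` does
not allocate (moves that are not available at `x`) is spent on staying at `x`. -/
def mhKernel [DecidableEq ι] (π : ι → ℝ) (Q : Matrix ι ι ℝ) : Matrix ι ι ℝ :=
  fun x y => acceptProb π Q x y * Q x y +
    if x = y then 1 - ∑ w, Q x w * acceptProb π Q x w else 0

end FiniteChains

/-! ### The Gaussian graphical model with a discrete spike-and-slab prior -/

/-- Data `Y` (row `i` is the observation `yᵢ ∈ ℝᵖ`) and prior parameters: slab probability `θ`,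
slab standard deviation `g`, rate parameter `lam`, largest admissible node degree `dbar`. -/
structure Setup (n p : ℕ) where
  Y : Matrix (Fin n) (Fin p) ℝ
  θ : ℝ
  g : ℝ
  lam : ℝ
  dbar : ℕ

/-- Potential edges: unordered pairs of distinct nodes. -/
abbrev Edge (p : ℕ) : Type := {e : Sym2 (Fin p) // ¬ e.IsDiag}

/-- Edge patterns `z` of column `j`: sets of nodes different from `j`. -/
abbrev Model {p : ℕ} (j : Fin p) : Type := Finset {k : Fin p // k ≠ j}

instance matrixMeasurableSpace (p : ℕ) : MeasurableSpace (Matrix (Fin p) (Fin p) ℝ) :=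
  inferInstanceAs (MeasurableSpace (Fin p → Fin p → ℝ))

/-- The symmetric matrix with diagonal `x.1` and off-diagonal entries `x.2`. -/
def assemble {p : ℕ} (x : (Fin p → ℝ) × (Edge p → ℝ)) : Matrix (Fin p) (Fin p) ℝ :=
  fun i k => if h : i = k then x.1 i else x.2 ⟨s(i, k), fun hd => h (Sym2.mk_isDiag_iff.mp hd)⟩

/-- Replace row `j` and column `j` of `Ω` by `v`, keeping the other entries. -/
def setColumn {p : ℕ} (Ω : Matrix (Fin p) (Fin p) ℝ) (j : Fin p) (v : Fin p → ℝ) :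
    Matrix (Fin p) (Fin p) ℝ :=
  fun i k => if i = j then v k else if k = j then v i else Ω i k

open Classical in
/-- The edge pattern of column `j` of `Ω`. -/
def pattern {p : ℕ} (j : Fin p) (Ω : Matrix (Fin p) (Fin p) ℝ) : Model j :=
  Finset.univ.filter fun k => Ω k.1 j ≠ 0

/-- The space `M₊(p)` of symmetric positive definite matrices. -/
def posDefSet (p : ℕ) : Set (Matrix (Fin p) (Fin p) ℝ) := {Ω | Ω.PosDef}

namespace Setup

variable {n p : ℕ} (D : Setup n p)

/-- `S = Yᵀ Y`. -/
def S : Matrix (Fin p) (Fin p) ℝ := D.Y.transpose * D.Y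

/-- The likelihood of `n` independent observations from `N(0, Ω⁻¹)`. -/
def likelihood (Ω : Matrix (Fin p) (Fin p) ℝ) : ℝ≥0∞ :=
  ENNReal.ofReal (∏ i, ((2 * Real.pi) ^ (-(p : ℝ) / 2) * Real.sqrt Ω.det *
    Real.exp (-(D.Y i ⬝ᵥ (Ω.mulVec (D.Y i))) / 2)))

/-- The law `Exp(lam / 2)` of a diagonal entry. -/
def diagLaw : Measure ℝ := expMeasure (D.lam / 2)

/-- The slab `N(0, g²)`. -/
def slabLaw : Measure ℝ := gaussianReal 0 (D.g ^ 2).toNNReal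

/-- The law of an off-diagonal entry: the slab or the Dirac spike at `0`. -/
def entryLaw (b : Bool) : Measure ℝ := if b then D.slabLaw else Measure.dirac 0

/-- The product of the entrywise laws given the graph `Z`, restricted to `M₊(p)`. -/
def unnormalizedPriorGiven (Z : Edge p → Bool) : Measure (Matrix (Fin p) (Fin p) ℝ) :=
  (((Measure.pi fun _ : Fin p => D.diagLaw).prod
    (Measure.pi fun e : Edge p => D.entryLaw (Z e))).map assemble).restrict (posDefSet p)

/-- `π(Ω | Z)`. -/
def priorGiven (Z : Edge p → Bool) : Measure (Matrix (Fin p) (Fin p) ℝ) :=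
  normalize (D.unnormalizedPriorGiven Z)

/-- The normalising constant `C₁(Z)` of `π(Ω | Z)`. -/
def C₁ (Z : Edge p → Bool) : ℝ≥0∞ := (D.unnormalizedPriorGiven Z Set.univ)⁻¹

open Classical in
/-- `π(Z)` up to normalisation: `C₁(Z)⁻¹ ∏_{i<j} θ^{Z_{ij}} (1-θ)^{1-Z_{ij}}` on graphs with all node
degrees at most `dbar`. -/
def graphWeight (Z : Edge p → Bool) : ℝ≥0∞ :=
  if ∀ i : Fin p, (Finset.univ.filter fun e : Edge p => Z e = true ∧ i ∈ e.1).card ≤ D.dbar then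
    (D.C₁ Z)⁻¹ * ENNReal.ofReal (∏ e, if Z e then D.θ else 1 - D.θ)
  else 0

/-- The spike-and-slab prior on `Ω`, the mixture of `π(Ω | Z)` over `π(Z)`. -/
def prior : Measure (Matrix (Fin p) (Fin p) ℝ) :=
  ∑ Z, (D.graphWeight Z / ∑ Z', D.graphWeight Z') • D.priorGiven Z

/-- The posterior `π(Ω | Y)`. -/
def posterior : Measure (Matrix (Fin p) (Fin p) ℝ) :=
  normalize (D.prior.withDensity D.likelihood)

/-! ### Full conditionals of a column -/

open Classical in
/-- The constraints on `Ω` under the prior: positive definite, with all node degrees at most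
`dbar`. -/
def feasible : Set (Matrix (Fin p) (Fin p) ℝ) :=
  {Ω | Ω.PosDef ∧ ∀ i, (Finset.univ.filter fun k => k ≠ i ∧ Ω i k ≠ 0).card ≤ D.dbar}

/-- The product of the entrywise laws of column `j` given its edge pattern `z`. -/
def columnLaw (j : Fin p) (z : Model j) : Measure (Fin p → ℝ) :=
  Measure.pi fun k => if h : k = j then D.diagLaw else D.entryLaw (decide (⟨k, h⟩ ∈ z))

/-- The joint conditional posterior of `(Z_{·j} = z, Ω_{·j})` given `Ω_{-j-j}`, up to a
factor that depends on `Ω_{-j-j}` only: prior of the column, times the indicator of the prior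
constraints, times likelihood. It is written as a law for the whole updated matrix, whose entries off row
and column `j` are those of `Ω`. It depends on `Ω` only through `Ω_{-j-j}`. -/
def columnJoint (j : Fin p) (Ω : Matrix (Fin p) (Fin p) ℝ) (z : Model j) :
    Measure (Matrix (Fin p) (Fin p) ℝ) :=
  ENNReal.ofReal (D.θ ^ z.card * (1 - D.θ) ^ (p - 1 - z.card)) •
    (((D.columnLaw j z).map (setColumn Ω j)).restrict D.feasible).withDensity D.likelihood

/-- `π(z | Y, Ω_{-j-j})`. -/
def modelProb (j : Fin p) (Ω : Matrix (Fin p) (Fin p) ℝ) (z : Model j) : ℝ :=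
  (D.columnJoint j Ω z Set.univ / ∑ z', D.columnJoint j Ω z' Set.univ).toReal

/-- `π(Ω_{·j} | z, Y, Ω_{-j-j})`, as a law for the whole updated matrix. -/
def columnGiven (j : Fin p) (Ω : Matrix (Fin p) (Fin p) ℝ) (z : Model j) :
    Measure (Matrix (Fin p) (Fin p) ℝ) :=
  normalize (D.columnJoint j Ω z)

/-! ### The ideal block Gibbs sampler -/

/-- The update of column `j` by an exact draw from
`π(Ω_{·j} | Y, Ω_{-j-j}) = ∑_z π(z | Y, Ω_{-j-j}) π(Ω_{·j} | z, Y, Ω_{-j-j})`. -/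
def gibbsColumn (j : Fin p) (Ω : Matrix (Fin p) (Fin p) ℝ) : Measure (Matrix (Fin p) (Fin p) ℝ) :=
  ∑ z, ENNReal.ofReal (D.modelProb j Ω z) • D.columnGiven j Ω z

end Setup

/-- The lazy random-scan kernel `1/2 I + 1/(2p) ∑_j P^j`. -/
def lazyScan {p : ℕ}
    (P : Fin p → Matrix (Fin p) (Fin p) ℝ → Measure (Matrix (Fin p) (Fin p) ℝ))
    (Ω : Matrix (Fin p) (Fin p) ℝ) : Measure (Matrix (Fin p) (Fin p) ℝ) :=
  (2 : ℝ≥0∞)⁻¹ • Measure.dirac Ω + (2 * (p : ℝ≥0∞))⁻¹ • ∑ j, P j Ω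

/-! ### Metropolis-Hastings proposals for the edge pattern -/

/-- Types of local moves. -/
inductive Move
  | birth
  | death
  | swap

/-- Birth and death probabilities are `pb` and `pd`; a swap has the remaining probability. -/
def Move.prob (pb pd : ℝ) : Move → ℝ
  | .birth => pb
  | .death => pd
  | .swap => 1 - pb - pd

/-- The models that are reachable from `z` by a move of the given type: add one node, remove one
node, or replace a node of `z` by one outside `z`. -/
def Move.nbhd {p : ℕ} {j : Fin p} (z : Model j) : Move → Finset (Model j)
  | .birth => Finset.univ.filter fun z' => (symmDiff z z').card = 1 ∧ z'.card = z.card + 1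
  | .death => Finset.univ.filter fun z' => (symmDiff z z').card = 1 ∧ z'.card + 1 = z.card
  | .swap => Finset.univ.filter fun z' => (symmDiff z z').card = 2 ∧ z'.card = z.card

/-- The three algorithms, with their tuning parameters: birth-death-swap proposals (`bdmh`),
globally informed independent proposals with tempering exponent `υ` (`gimh`), and locally informed
thresholded proposals (`lit`), whose weights for moves of type `m` are
truncated to `[lo m, hi m]`. -/
inductive MHAlgorithm
  | bdmh (pb pd : ℝ)
  | gimh (υ : ℝ)
  | lit (pb pd : ℝ) (lo hi : Move → ℝ)

/-- The admissible tuning parameters. -/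
def MHAlgorithm.IsValid : MHAlgorithm → Prop
  | .bdmh pb pd => 0 < pb ∧ pb < 1 ∧ 0 < pd ∧ pd < 1 ∧ pb + pd ≤ 1
  | .gimh υ => 0 < υ ∧ υ ≤ 1
  | .lit pb pd lo hi => 0 < pb ∧ pb < 1 ∧ 0 < pd ∧ pd < 1 ∧ pb + pd ≤ 1 ∧
      ∀ m, 0 ≤ lo m ∧ lo m ≤ hi m

/-- Birth-death-swap proposal: `Q(z' | z)` is entry `(z, z')`. -/
def bdProposal {p : ℕ} (j : Fin p) (pb pd : ℝ) : Matrix (Model j) (Model j) ℝ :=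
  fun z z' =>
    if (symmDiff z z').card = 1 ∧ z'.card = z.card + 1 ∧ z.card < p - 1 then
      pb / ((p : ℝ) - 1 - z.card)
    else if (symmDiff z z').card = 1 ∧ z'.card + 1 = z.card ∧ 0 < z.card then
      pd / z.card
    else if (symmDiff z z').card = 2 ∧ z'.card = z.card ∧ 0 < z.card ∧ z.card < p - 1 then
      (1 - pb - pd) / (z.card * ((p : ℝ) - 1 - z.card))
    else 0

open Classical in
/-- Locally informed proposal for the target `π`: choose a type of move, then a neighbour `z'` of that
type with probability proportional to `π(z')/π(z)` truncated to `[lo, hi]`. -/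
def litProposal {p : ℕ} (j : Fin p) (pb pd : ℝ) (lo hi : Move → ℝ) (π : Model j → ℝ) :
    Matrix (Model j) (Model j) ℝ :=
  let w : Move → Model j → Model j → ℝ := fun m z z' => max (lo m) (min (π z' / π z) (hi m))
  let q : Move → Model j → Model j → ℝ := fun m z z' =>
    if z' ∈ m.nbhd z then m.prob pb pd * w m z z' / ∑ z'' ∈ m.nbhd z, w m z z'' else 0
  fun z z' => q .birth z z' + q .death z z' + q .swap z z'

namespace Setup

variable {n p : ℕ} (D : Setup n p)

/-- `W_z = [S_{-j-j}]_{zz} + g⁻² I_z`. -/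
def W (j : Fin p) (z : Model j) : Matrix z z ℝ :=
  D.S.submatrix (fun a => a.1.1) (fun a => a.1.1) + (D.g ^ 2)⁻¹ • (1 : Matrix z z ℝ)

/-- `S_{zj}`. -/
def Sz (j : Fin p) (z : Model j) : z → ℝ := fun a => D.S a.1.1 j

/-- The linear regression posterior `π^{LR}_j(z | Y)`, up to normalisation. -/
def lrWeight (j : Fin p) (z : Model j) : ℝ :=
  if z.card ≤ D.dbar then
    D.θ ^ z.card * (1 - D.θ) ^ (p - 1 - z.card) /
        (D.g ^ z.card * Real.sqrt (D.W j z).det) *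
      (1 / (D.lam + D.S j j - D.Sz j z ⬝ᵥ ((D.W j z)⁻¹.mulVec (D.Sz j z)))) ^ ((n : ℝ) / 2 + 1)
  else 0

/-- Independent proposal from the linear regression posterior raised to the power `υ`. -/
def giProposal (j : Fin p) (υ : ℝ) : Matrix (Model j) (Model j) ℝ :=
  fun _ z' => D.lrWeight j z' ^ υ / ∑ z'', D.lrWeight j z'' ^ υ

/-- The proposal `Q^j(z' | z, Ω_{-j-j}, Y)` of each algorithm. -/
def proposal (j : Fin p) (Ω : Matrix (Fin p) (Fin p) ℝ) :
    MHAlgorithm → Matrix (Model j) (Model j) ℝ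
  | .bdmh pb pd => bdProposal j pb pd
  | .gimh υ => D.giProposal j υ
  | .lit pb pd lo hi => litProposal j pb pd lo hi (D.modelProb j Ω)

/-- The conditional Metropolis-Hastings kernel on edge patterns given `Ω_{-j-j}`: `M` successive
Metropolis-Hastings updates with target `π(z | Y, Ω_{-j-j})`. -/
def condKernel (alg : MHAlgorithm) (M : ℕ) (j : Fin p) (Ω : Matrix (Fin p) (Fin p) ℝ) :
    Matrix (Model j) (Model j) ℝ :=
  mhKernel (D.modelProb j Ω) (D.proposal j Ω alg) ^ M

/-- The spectral gap of the conditional Metropolis-Hastings kernel. -/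
def condGap (alg : MHAlgorithm) (M : ℕ) (j : Fin p) (Ω : Matrix (Fin p) (Fin p) ℝ) : ℝ :=
  spectralGap (D.modelProb j Ω) (D.condKernel alg M j Ω)

/-- Metropolis-within-Gibbs update of column `j`: move the edge pattern by the conditional
Metropolis-Hastings kernel, then draw the column exactly given the new pattern. -/
def mhColumn (alg : MHAlgorithm) (M : ℕ) (j : Fin p) (Ω : Matrix (Fin p) (Fin p) ℝ) :
    Measure (Matrix (Fin p) (Fin p) ℝ) :=
  ∑ z, ENNReal.ofReal (D.condKernel alg M j Ω (pattern j Ω) z) • D.columnGiven j Ω z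

/-- `P^L_{Gibbs}`. -/
def lazyGibbs : Matrix (Fin p) (Fin p) ℝ → Measure (Matrix (Fin p) (Fin p) ℝ) :=
  lazyScan D.gibbsColumn

/-- `P^L_{MH}`. -/
def lazyMH (alg : MHAlgorithm) (M : ℕ) :
    Matrix (Fin p) (Fin p) ℝ → Measure (Matrix (Fin p) (Fin p) ℝ) :=
  lazyScan (D.mhColumn alg M)

end Setup

end GGM

end

noncomputable section

namespace GGM

/-! ### Reversible finite chains -/

section AcceptProb

variable {ι : Type*}

/-! Fix a column `j` and the submatrix `Ω_{-j-j}`. Both column updates have two stages: choose a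
pattern `z'`, then draw the column from its exact conditional law given `z'`. They differ only in
the first stage, which is an independent draw from `π(z')` for Gibbs and a step of the reversible
chain `K = condKernel` for Metropolis-Hastings. Write `f(z)` for the conditional probability of a
test set `A` given `z`. If the column is in equilibrium given `Ω_{-j-j}`, the flow out of `A` equals
`E[f(1-f)] + Var(f)` for Gibbs and `E[f(1-f)] + E(f,f)` for Metropolis-Hastings, the last term being
the Dirichlet form of `K`. The gap bounds the Dirichlet form below by `Gap * Var(f)`. Since `K` need
not be positive, its gap can exceed `1`, but it is at most `2`, so `Gap/2` times the term
`E[f(1-f)]` is at most that term. Hence the Metropolis-Hastings flow is at least `Gap/2` times the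
Gibbs flow (`half_spectralGap_mul_flow_le`). This is the origin of the factor `1/2`.

To integrate this over the posterior, the stationary flow must be an average of the conditional
flows. The constants `C₁(Z)` in the two layers of the prior cancel, so the prior is proportional to
a product measure restricted to the feasible matrices (`IsRegular.prior_eq`). Resampling the
coordinates of one column preserves a product measure, which yields the disintegration
`IsRegular.lintegral_posteriorWeight`, the invariance of the exact update, and the flow identity
`IsRegular.setLIntegral_columnUpdate`.

On `B` the conditional comparison holds with half the infimum of the gaps. Off `B` the conditional
Gibbs flow is at most `1`, so the loss is at most a multiple of `π(Bᶜ)`. Averaging over columns and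
dividing by `π(A) > s` gives the claim. The lazy half of either kernel contributes nothing to the
flow out of `A`. -/

theorem acceptProb_le_one (π : ι → ℝ) (Q : Matrix ι ι ℝ) (x y : ι) : acceptProb π Q x y ≤ 1 :=
  min_le_left _ _

theorem acceptProb_nonneg {π : ι → ℝ} {Q : Matrix ι ι ℝ} (hπ : ∀ x, 0 ≤ π x)
    (hQ : ∀ x y, 0 ≤ Q x y) (x y : ι) : 0 ≤ acceptProb π Q x y :=
  le_min zero_le_one
    (div_nonneg (mul_nonneg (hπ _) (hQ _ _)) (mul_nonneg (hπ _) (hQ _ _)))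

/-- The right side is symmetric in `x` and `y`, which is detailed balance. It also holds when the
denominator in the acceptance ratio vanishes, since then both sides are `0`. -/
theorem mul_acceptProb_mul {π : ι → ℝ} {Q : Matrix ι ι ℝ} (hπ : ∀ x, 0 ≤ π x)
    (hQ : ∀ x y, 0 ≤ Q x y) (x y : ι) :
    π x * (acceptProb π Q x y * Q x y) = min (π x * Q x y) (π y * Q y x) := by
  have h1 : 0 ≤ π x * Q x y := mul_nonneg (hπ _) (hQ _ _)
  have h2 : 0 ≤ π y * Q y x := mul_nonneg (hπ _) (hQ _ _)
  rcases h1.eq_or_lt with h | h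
  · rw [← h, min_eq_left h2]
    calc π x * (acceptProb π Q x y * Q x y) = acceptProb π Q x y * (π x * Q x y) := by ring
      _ = 0 := by rw [← h, mul_zero]
  · calc π x * (acceptProb π Q x y * Q x y)
        = min 1 (π y * Q y x / (π x * Q x y)) * (π x * Q x y) := by unfold acceptProb; ring
      _ = _ := by
        rw [min_mul_of_nonneg _ _ h.le, one_mul, div_mul_cancel₀ _ h.ne']

end AcceptProb

section FiniteChains

variable {ι : Type*} [Fintype ι]

/-- `K` is a stochastic matrix that is reversible with respect to `π`. -/
structure IsReversibleChain (π : ι → ℝ) (K : Matrix ι ι ℝ) : Prop where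
  nonneg : ∀ x y, 0 ≤ K x y
  row_sum : ∀ x, ∑ y, K x y = 1
  balance : ∀ x y, π x * K x y = π y * K y x

theorem IsReversibleChain.one [DecidableEq ι] (π : ι → ℝ) :
    IsReversibleChain π (1 : Matrix ι ι ℝ) where
  nonneg x y := by by_cases h : x = y <;> simp [Matrix.one_apply, h]
  row_sum x := by simp [Matrix.one_apply]
  balance x y := by
    by_cases h : x = y
    · rw [h]
    · simp [h, Ne.symm h]

theorem IsReversibleChain.pow [DecidableEq ι] {π : ι → ℝ} {K : Matrix ι ι ℝ}
    (h : IsReversibleChain π K) (m : ℕ) : IsReversibleChain π (K ^ m) := by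
  induction m with
  | zero => simpa using IsReversibleChain.one π
  | succ m ih =>
    refine ⟨fun x y => ?_, fun x => ?_, fun x y => ?_⟩
    · rw [pow_succ, Matrix.mul_apply]
      exact Finset.sum_nonneg fun w _ => mul_nonneg (ih.nonneg _ _) (h.nonneg _ _)
    · simp only [pow_succ, Matrix.mul_apply]
      rw [Finset.sum_comm]
      simp only [← Finset.mul_sum, h.row_sum, mul_one, ih.row_sum]
    -- The two sides are expanded with the extra factor `K` at opposite ends, so that reversing a
    -- path matches them term by term.
    · rw [pow_succ, Matrix.mul_apply, ← pow_succ, pow_succ', Matrix.mul_apply,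
        Finset.mul_sum, Finset.mul_sum]
      refine Finset.sum_congr rfl fun w _ => ?_
      calc π x * ((K ^ m) x w * K w y) = (π x * (K ^ m) x w) * K w y := by ring
        _ = (π w * K w y) * (K ^ m) w x := by rw [ih.balance]; ring
        _ = π y * (K y w * (K ^ m) w x) := by rw [h.balance]; ring

/-- A Metropolis-Hastings kernel with a substochastic proposal is stochastic and reversible. -/
theorem isReversibleChain_mhKernel [DecidableEq ι] {π : ι → ℝ} {Q : Matrix ι ι ℝ}
    (hπ : ∀ x, 0 ≤ π x) (hQ : ∀ x y, 0 ≤ Q x y) (hQ1 : ∀ x, ∑ y, Q x y ≤ 1) :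
    IsReversibleChain π (mhKernel π Q) where
  nonneg x y := by
    unfold mhKernel
    refine add_nonneg (mul_nonneg (acceptProb_nonneg hπ hQ _ _) (hQ _ _)) ?_
    split_ifs
    · rw [sub_nonneg]
      exact (Finset.sum_le_sum fun w _ =>
        mul_le_of_le_one_right (hQ x w) (acceptProb_le_one π Q x w)).trans (hQ1 x)
    · exact le_rfl
  row_sum x := by
    simp only [mhKernel, Finset.sum_add_distrib, Finset.sum_ite_eq, Finset.mem_univ, if_true]
    simp only [mul_comm (Q x _)]
    ring
  balance x y := by
    by_cases h : x = y
    · rw [h]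
    · simp only [mhKernel, h, Ne.symm h, if_false, add_zero]
      rw [mul_acceptProb_mul hπ hQ, mul_acceptProb_mul hπ hQ, min_comm]

variable {π : ι → ℝ} {K : Matrix ι ι ℝ}

theorem variance_eq_sum_sq (h1 : ∑ x, π x = 1) (f : ι → ℝ) :
    variance π f = ∑ x, π x * (f x - ∑ y, π y * f y) ^ 2 := by
  set m := ∑ y, π y * f y with hm
  have : ∀ x, π x * (f x - m) ^ 2 = π x * f x ^ 2 - 2 * m * (π x * f x) + m ^ 2 * π x :=
    fun x => by ring
  simp only [this, Finset.sum_add_distrib, Finset.sum_sub_distrib, ← Finset.mul_sum, h1, ← hm]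
  rw [variance, ← hm]
  ring

theorem variance_nonneg (hπ : ∀ x, 0 ≤ π x) (h1 : ∑ x, π x = 1) (f : ι → ℝ) :
    0 ≤ variance π f := by
  rw [variance_eq_sum_sq h1]
  exact Finset.sum_nonneg fun x _ => mul_nonneg (hπ x) (sq_nonneg _)

theorem dirichletForm_nonneg (hπ : ∀ x, 0 ≤ π x) (hK : IsReversibleChain π K) (f : ι → ℝ) :
    0 ≤ dirichletForm π K f :=
  mul_nonneg (by norm_num) <| Finset.sum_nonneg fun x _ => Finset.sum_nonneg fun y _ =>
    mul_nonneg (sq_nonneg _) (mul_nonneg (hπ x) (hK.nonneg x y))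

theorem IsReversibleChain.sum_left (hK : IsReversibleChain π K) (f : ι → ℝ) :
    ∑ x, ∑ y, f x * (π x * K x y) = ∑ x, π x * f x := by
  refine Finset.sum_congr rfl fun x _ => ?_
  rw [← Finset.mul_sum, ← Finset.mul_sum, hK.row_sum, mul_one, mul_comm]

theorem IsReversibleChain.sum_right (hK : IsReversibleChain π K) (f : ι → ℝ) :
    ∑ x, ∑ y, f y * (π x * K x y) = ∑ x, π x * f x := by
  rw [Finset.sum_comm, ← hK.sum_left f]
  exact Finset.sum_congr rfl fun x _ => Finset.sum_congr rfl fun y _ => by rw [hK.balance]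

theorem dirichletForm_eq (hK : IsReversibleChain π K) (f : ι → ℝ) :
    dirichletForm π K f = ∑ x, π x * f x ^ 2 - ∑ x, ∑ y, f x * f y * (π x * K x y) := by
  have : ∀ x y, (f y - f x) ^ 2 * (π x * K x y) = f x ^ 2 * (π x * K x y)
      + f y ^ 2 * (π x * K x y) - 2 * (f x * f y * (π x * K x y)) := fun x y => by ring
  simp only [dirichletForm, this, Finset.sum_add_distrib, Finset.sum_sub_distrib]
  rw [hK.sum_left (fun x => f x ^ 2), hK.sum_right (fun x => f x ^ 2)]
  simp only [← Finset.mul_sum]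
  ring

/-- From `(a - b)² ≤ 2a² + 2b²` applied to the centred values, with both marginals of `π(x) K(x,y)`
equal to `π`. -/
theorem dirichletForm_le_two_mul_variance (hπ : ∀ x, 0 ≤ π x) (h1 : ∑ x, π x = 1)
    (hK : IsReversibleChain π K) (f : ι → ℝ) :
    dirichletForm π K f ≤ 2 * variance π f := by
  rw [variance_eq_sum_sq h1]
  set m := ∑ y, π y * f y
  have key : ∑ x, ∑ y, (f y - f x) ^ 2 * (π x * K x y) ≤
      ∑ x, ∑ y, (2 * ((f x - m) ^ 2 * (π x * K x y)) + 2 * ((f y - m) ^ 2 * (π x * K x y))) := by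
    refine Finset.sum_le_sum fun x _ => Finset.sum_le_sum fun y _ => ?_
    have := mul_nonneg (hπ x) (hK.nonneg x y)
    nlinarith [mul_nonneg (sq_nonneg (f x - m + (f y - m))) this]
  simp only [Finset.sum_add_distrib, ← Finset.mul_sum] at key
  have e1 := hK.sum_left (fun x => (f x - m) ^ 2)
  have e2 := hK.sum_right (fun x => (f x - m) ^ 2)
  simp only [← Finset.mul_sum] at key e1 e2
  rw [dirichletForm]
  linarith

theorem spectralGap_nonneg (hπ : ∀ x, 0 ≤ π x) (hK : IsReversibleChain π K) :
    0 ≤ spectralGap π K := by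
  unfold spectralGap
  split_ifs
  · refine Real.sInf_nonneg ?_
    rintro r ⟨f, hf, rfl⟩
    exact div_nonneg (dirichletForm_nonneg hπ hK f) hf.le
  · exact zero_le_one

theorem spectralGap_le_div (hπ : ∀ x, 0 ≤ π x) (hK : IsReversibleChain π K) {f : ι → ℝ}
    (hf : 0 < variance π f) : spectralGap π K ≤ dirichletForm π K f / variance π f := by
  rw [spectralGap, if_pos ⟨f, hf⟩]
  refine csInf_le ⟨0, ?_⟩ ⟨f, hf, rfl⟩
  rintro r ⟨f, hf, rfl⟩
  exact div_nonneg (dirichletForm_nonneg hπ hK f) hf.le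

theorem spectralGap_mul_variance_le (hπ : ∀ x, 0 ≤ π x) (h1 : ∑ x, π x = 1)
    (hK : IsReversibleChain π K) (f : ι → ℝ) :
    spectralGap π K * variance π f ≤ dirichletForm π K f := by
  rcases (variance_nonneg hπ h1 f).eq_or_lt with h | h
  · rw [← h, mul_zero]
    exact dirichletForm_nonneg hπ hK f
  · exact (le_div_iff₀ h).mp (spectralGap_le_div hπ hK h)

/-- The spectrum of a reversible chain may reach `-1`, so `1` would not do as a bound in general.
The value `1` assigned to a degenerate target also obeys it. -/
theorem spectralGap_le_two (hπ : ∀ x, 0 ≤ π x) (h1 : ∑ x, π x = 1)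
    (hK : IsReversibleChain π K) : spectralGap π K ≤ 2 := by
  by_cases h : ∃ f, 0 < variance π f
  · obtain ⟨f, hf⟩ := h
    exact (spectralGap_le_div hπ hK hf).trans
      ((div_le_iff₀ hf).mpr (dirichletForm_le_two_mul_variance hπ h1 hK f))
  · rw [spectralGap, if_neg h]
    norm_num

/-- The flow out of a set `A` of a two-stage chain (`f z` is the probability of `A` under
stage two given `z`) is at least half the gap of stage one times the flow of the
independent sampler. -/
theorem half_spectralGap_mul_flow_le (hπ : ∀ x, 0 ≤ π x) (h1 : ∑ x, π x = 1)
    (hK : IsReversibleChain π K) {f : ι → ℝ} (hf0 : ∀ x, 0 ≤ f x) (hf1 : ∀ x, f x ≤ 1) :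
    spectralGap π K / 2 * ∑ x, π x * f x * ∑ y, π y * (1 - f y) ≤
      ∑ x, π x * f x * ∑ y, K x y * (1 - f y) := by
  have hG : ∑ x, π x * f x * ∑ y, π y * (1 - f y) =
      ∑ x, π x * (f x * (1 - f x)) + variance π f := by
    rw [← Finset.sum_mul, variance]
    simp only [mul_sub, mul_one, Finset.sum_sub_distrib, h1, pow_two]
    ring
  have hM : ∑ x, π x * f x * ∑ y, K x y * (1 - f y) =
      ∑ x, π x * (f x * (1 - f x)) + dirichletForm π K f := by
    rw [dirichletForm_eq hK]
    have : ∀ x, π x * f x * ∑ y, K x y * (1 - f y) =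
        π x * f x - ∑ y, f x * f y * (π x * K x y) := fun x => by
      simp only [mul_sub, mul_one, Finset.sum_sub_distrib, hK.row_sum, Finset.mul_sum]
      congr 1
      exact Finset.sum_congr rfl fun y _ => by ring
    rw [Finset.sum_congr rfl fun x _ => this x]
    simp only [Finset.sum_sub_distrib, mul_sub, mul_one, pow_two]
    ring
  have hE : 0 ≤ ∑ x, π x * (f x * (1 - f x)) := Finset.sum_nonneg fun x _ =>
    mul_nonneg (hπ x) (mul_nonneg (hf0 x) (sub_nonneg.mpr (hf1 x)))
  have hV := variance_nonneg hπ h1 f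
  have hgv := spectralGap_mul_variance_le hπ h1 hK f
  have hg0 := spectralGap_nonneg hπ hK
  have hg2 := spectralGap_le_two hπ h1 hK
  rw [hG, hM]
  -- Half the gap is at most `1`, which handles the `f(1-f)` term. For the variance term only half
  -- of the Poincaré inequality is used.
  nlinarith [mul_nonneg hg0 hV, mul_nonneg (sub_nonneg.mpr hg2) hE]

end FiniteChains

/-! ### The proposals are substochastic -/

section Moves

variable {p : ℕ} {j : Fin p}

theorem card_ne_eq (j : Fin p) : Fintype.card {k : Fin p // k ≠ j} = p - 1 := by
  simp

/-- Every birth inserts an element of the complement, so the neighbourhood lies in the image of the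
complement. Upper bounds on the neighbourhood sizes suffice, because the proposals need only be
substochastic: missing mass goes to staying put. -/
theorem Move.card_nbhd_birth_le (z : Model j) : (Move.birth.nbhd z).card ≤ p - 1 - z.card := by
  classical
  have hsub : Move.birth.nbhd z ⊆ (zᶜ).image fun a => insert a z := by
    intro z' hz'
    simp only [Move.nbhd, Finset.mem_filter, Finset.mem_univ, true_and] at hz'
    obtain ⟨h1, h2⟩ := hz'
    have hd : (z' \ z).card = (z \ z').card + 1 := by
      have := Finset.card_sdiff_add_card_inter z' z
      have := Finset.card_sdiff_add_card_inter z z'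
      rw [Finset.inter_comm] at this
      omega
    have hs : (symmDiff z z').card = (z \ z').card + (z' \ z).card :=
      Finset.card_union_of_disjoint disjoint_sdiff_sdiff
    have h0 : z \ z' = ∅ := Finset.card_eq_zero.mp (by omega)
    obtain ⟨a, ha⟩ := Finset.card_eq_one.mp (show (z' \ z).card = 1 by omega)
    rw [Finset.mem_image]
    refine ⟨a, ?_, ?_⟩
    · have : a ∈ z' \ z := by simp [ha]
      simpa using (Finset.mem_sdiff.mp this).2
    · rw [Finset.insert_eq, ← ha,
        Finset.sdiff_union_of_subset (Finset.sdiff_eq_empty_iff_subset.mp h0)]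
  refine (Finset.card_le_card hsub).trans (Finset.card_image_le.trans ?_)
  rw [Finset.card_compl, card_ne_eq]

theorem Move.card_nbhd_death_le (z : Model j) : (Move.death.nbhd z).card ≤ z.card := by
  classical
  have hsub : Move.death.nbhd z ⊆ z.image fun a => z.erase a := by
    intro z' hz'
    simp only [Move.nbhd, Finset.mem_filter, Finset.mem_univ, true_and] at hz'
    obtain ⟨h1, h2⟩ := hz'
    have hd : (z' \ z).card + 1 = (z \ z').card := by
      have := Finset.card_sdiff_add_card_inter z' z
      have := Finset.card_sdiff_add_card_inter z z'
      rw [Finset.inter_comm] at this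
      omega
    have hs : (symmDiff z z').card = (z \ z').card + (z' \ z).card :=
      Finset.card_union_of_disjoint disjoint_sdiff_sdiff
    have h0 : z' \ z = ∅ := Finset.card_eq_zero.mp (by omega)
    obtain ⟨a, ha⟩ := Finset.card_eq_one.mp (show (z \ z').card = 1 by omega)
    have haz : a ∈ z \ z' := by simp [ha]
    rw [Finset.mem_image]
    refine ⟨a, (Finset.mem_sdiff.mp haz).1, ?_⟩
    rw [← Finset.sdiff_singleton_eq_erase, ← ha,
      Finset.sdiff_sdiff_eq_self (Finset.sdiff_eq_empty_iff_subset.mp h0)]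
  exact (Finset.card_le_card hsub).trans Finset.card_image_le

theorem Move.card_nbhd_swap_le (z : Model j) :
    (Move.swap.nbhd z).card ≤ z.card * (p - 1 - z.card) := by
  classical
  have hsub : Move.swap.nbhd z ⊆ (z ×ˢ zᶜ).image fun a => insert a.2 (z.erase a.1) := by
    intro z' hz'
    simp only [Move.nbhd, Finset.mem_filter, Finset.mem_univ, true_and] at hz'
    obtain ⟨h1, h2⟩ := hz'
    have hd : (z' \ z).card = (z \ z').card := by
      have := Finset.card_sdiff_add_card_inter z' z
      have := Finset.card_sdiff_add_card_inter z z'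
      rw [Finset.inter_comm] at this
      omega
    have hs : (symmDiff z z').card = (z \ z').card + (z' \ z).card :=
      Finset.card_union_of_disjoint disjoint_sdiff_sdiff
    obtain ⟨b, hb⟩ := Finset.card_eq_one.mp (show (z' \ z).card = 1 by omega)
    obtain ⟨a, ha⟩ := Finset.card_eq_one.mp (show (z \ z').card = 1 by omega)
    have haz : a ∈ z \ z' := by simp [ha]
    have hbz : b ∈ z' \ z := by simp [hb]
    rw [Finset.mem_image]
    refine ⟨(a, b), ?_, ?_⟩
    · simp only [Finset.mem_product, Finset.mem_compl]
      exact ⟨(Finset.mem_sdiff.mp haz).1, (Finset.mem_sdiff.mp hbz).2⟩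
    · simp only
      rw [← Finset.sdiff_singleton_eq_erase, ← ha, Finset.insert_eq, ← hb,
        sdiff_sdiff_right_self, Finset.inf_eq_inter, Finset.inter_comm,
        Finset.sdiff_union_inter]
  refine (Finset.card_le_card hsub).trans (Finset.card_image_le.trans ?_)
  rw [Finset.card_product, Finset.card_compl, card_ne_eq]

theorem card_le_sub_one (z : Model j) : z.card ≤ p - 1 := by
  rw [← card_ne_eq j]
  exact Finset.card_le_univ z

theorem cast_sub_one_sub_card (z : Model j) :
    ((p - 1 - z.card : ℕ) : ℝ) = (p : ℝ) - 1 - z.card := by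
  have := card_le_sub_one z
  have := j.pos
  rw [Nat.cast_sub (by omega), Nat.cast_sub (by omega), Nat.cast_one]

/-- A proposal that draws a type of move and then spreads its probability over the moves of that
type is substochastic. -/
theorem sum_sum_moves_le_one {pb pd : ℝ} {q : Move → Model j → ℝ}
    (hq : ∀ m, ∑ z', q m z' ≤ m.prob pb pd) :
    ∑ z', (q .birth z' + q .death z' + q .swap z') ≤ 1 := by
  rw [Finset.sum_add_distrib, Finset.sum_add_distrib]
  have h1 := hq .birth
  have h2 := hq .death
  have h3 := hq .swap
  simp only [Move.prob] at h1 h2 h3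
  linarith

theorem bdProposal_nonneg {pb pd : ℝ} (hb : 0 ≤ pb) (hd : 0 ≤ pd) (hs : pb + pd ≤ 1)
    (z z' : Model j) : 0 ≤ bdProposal j pb pd z z' := by
  have h0 : (0 : ℝ) ≤ (p : ℝ) - 1 - z.card := by
    rw [← cast_sub_one_sub_card]; positivity
  unfold bdProposal
  split_ifs
  · exact div_nonneg hb h0
  · positivity
  · exact div_nonneg (by linarith) (mul_nonneg (by positivity) h0)
  · exact le_rfl

theorem sum_ite_mem_div_le {ι : Type*} [Fintype ι] [DecidableEq ι] (s : Finset ι) {c : ℝ}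
    (hc : 0 ≤ c) {N : ℕ} (hN : s.card ≤ N) : ∑ x, (if x ∈ s then c / N else 0) ≤ c := by
  rw [Finset.sum_ite_mem, Finset.univ_inter, Finset.sum_const, nsmul_eq_mul, mul_div_left_comm]
  exact mul_le_of_le_one_right hc (div_le_one_of_le₀ (by exact_mod_cast hN) (Nat.cast_nonneg _))

theorem sum_bdProposal_le_one {pb pd : ℝ} (hb : 0 ≤ pb) (hd : 0 ≤ pd) (hs : pb + pd ≤ 1)
    (z : Model j) : ∑ z', bdProposal j pb pd z z' ≤ 1 := by
  classical
  let N : Move → ℕ := fun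
    | .birth => p - 1 - z.card
    | .death => z.card
    | .swap => z.card * (p - 1 - z.card)
  have hp : ∀ m : Move, 0 ≤ m.prob pb pd := by
    rintro (_ | _ | _) <;> simp only [Move.prob] <;> linarith
  let q : Move → Model j → ℝ := fun m z' => if z' ∈ m.nbhd z then m.prob pb pd / N m else 0
  have hq0 : ∀ m z', 0 ≤ q m z' := fun m z' => by
    simp only [q]
    split_ifs
    · exact div_nonneg (hp m) (Nat.cast_nonneg _)
    · exact le_rfl
  have hq : ∀ m, ∑ z', q m z' ≤ m.prob pb pd := by
    rintro (_ | _ | _)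
    · exact sum_ite_mem_div_le _ (hp _) (Move.card_nbhd_birth_le z)
    · exact sum_ite_mem_div_le _ (hp _) (Move.card_nbhd_death_le z)
    · exact sum_ite_mem_div_le _ (hp _) (Move.card_nbhd_swap_le z)
  refine le_trans (Finset.sum_le_sum fun z' _ => ?_) (sum_sum_moves_le_one hq)
  have hB := hq0 .birth z'
  have hD := hq0 .death z'
  have hS := hq0 .swap z'
  unfold bdProposal
  split_ifs with h1 h2 h3
  · have : q .birth z' = pb / ((p : ℝ) - 1 - z.card) := by
      rw [← cast_sub_one_sub_card]
      have hm : z' ∈ Move.birth.nbhd z := by simpa [Move.nbhd] using ⟨h1.1, h1.2.1⟩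
      simp only [q, if_pos hm]
      rfl
    linarith
  · have : q .death z' = pd / z.card := by
      have hm : z' ∈ Move.death.nbhd z := by simpa [Move.nbhd] using ⟨h2.1, h2.2.1⟩
      simp only [q, if_pos hm]
      rfl
    linarith
  · have : q .swap z' = (1 - pb - pd) / (z.card * ((p : ℝ) - 1 - z.card)) := by
      rw [← cast_sub_one_sub_card, ← Nat.cast_mul]
      have hm : z' ∈ Move.swap.nbhd z := by simpa [Move.nbhd] using ⟨h3.1, h3.2.1⟩
      simp only [q, if_pos hm]
      rfl
    linarith
  · linarith

theorem litProposal_nonneg {pb pd : ℝ} (hb : 0 ≤ pb) (hd : 0 ≤ pd) (hs : pb + pd ≤ 1)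
    {lo hi : Move → ℝ} (hlo : ∀ m, 0 ≤ lo m) (π : Model j → ℝ) (z z' : Model j) :
    0 ≤ litProposal j pb pd lo hi π z z' := by
  have hw : ∀ m z z', 0 ≤ max (lo m) (min (π z' / π z) (hi m)) := fun m z z' =>
    (hlo m).trans (le_max_left _ _)
  have hp : ∀ m : Move, 0 ≤ m.prob pb pd := by
    rintro (_ | _ | _) <;> simp only [Move.prob] <;> linarith
  have hq : ∀ m : Move, 0 ≤ if z' ∈ m.nbhd z then m.prob pb pd *
      max (lo m) (min (π z' / π z) (hi m)) /
        ∑ z'' ∈ m.nbhd z, max (lo m) (min (π z'' / π z) (hi m)) else 0 := fun m => by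
    split_ifs
    · exact div_nonneg (mul_nonneg (hp m) (hw m z z')) (Finset.sum_nonneg fun x _ => hw m z x)
    · exact le_rfl
  exact add_nonneg (add_nonneg (hq _) (hq _)) (hq _)

theorem sum_litProposal_le_one {pb pd : ℝ} (hb : 0 ≤ pb) (hd : 0 ≤ pd) (hs : pb + pd ≤ 1)
    (lo hi : Move → ℝ) (π : Model j → ℝ) (z : Model j) :
    ∑ z', litProposal j pb pd lo hi π z z' ≤ 1 := by
  classical
  have hp : ∀ m : Move, 0 ≤ m.prob pb pd := by
    rintro (_ | _ | _) <;> simp only [Move.prob] <;> linarith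
  refine sum_sum_moves_le_one (pb := pb) (pd := pd)
    (q := fun m z' => if z' ∈ m.nbhd z then m.prob pb pd *
      max (lo m) (min (π z' / π z) (hi m)) /
        ∑ z'' ∈ m.nbhd z, max (lo m) (min (π z'' / π z) (hi m)) else 0) fun m => ?_
  rw [Finset.sum_ite_mem, Finset.univ_inter, ← Finset.sum_div, ← Finset.mul_sum, mul_div_assoc]
  -- If the neighbourhood is empty or all its weights vanish, the quotient is `0 / 0 = 0`. This is
  -- why only `≤` is available.
  exact mul_le_of_le_one_right (hp m) (div_self_le_one _)

end Moves

/-! ### Proposals and conditional chains of the three algorithms -/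

namespace Setup

variable {n p : ℕ} (D : Setup n p)

theorem posDef_W (hg : 0 < D.g) (j : Fin p) (z : Model j) : (D.W j z).PosDef := by
  unfold W S
  refine Matrix.PosDef.posSemidef_add ?_ ?_
  · have := (Matrix.posSemidef_conjTranspose_mul_self D.Y).submatrix
      (fun a : z => (a.1.1 : Fin p))
    simpa [Matrix.conjTranspose_eq_transpose_of_trivial] using this
  · exact Matrix.PosDef.one.smul (by positivity)

/-- The residual sum of squares of the ridge regression of column `j` of `Y` on the columns in `z`
is nonnegative. -/
theorem residual_nonneg (hg : 0 < D.g) (j : Fin p) (z : Model j) :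
    0 ≤ D.S j j - D.Sz j z ⬝ᵥ ((D.W j z)⁻¹.mulVec (D.Sz j z)) := by
  set u := (D.W j z)⁻¹.mulVec (D.Sz j z) with hu
  have hW : (D.W j z).mulVec u = D.Sz j z := by
    rw [hu, Matrix.mulVec_mulVec, Matrix.mul_nonsing_inv _ (D.posDef_W hg j z).det_pos.ne'.isUnit,
      Matrix.one_mulVec]
  let X : Matrix (Fin n) z ℝ := D.Y.submatrix id fun a => a.1.1
  let y : Fin n → ℝ := fun i => D.Y i j
  have hS : D.Sz j z = X.transpose.mulVec y := by
    ext a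
    simp [Sz, S, X, y, Matrix.mul_apply, Matrix.mulVec, dotProduct]
  have hWX : D.W j z = X.transpose * X + (D.g ^ 2)⁻¹ • (1 : Matrix z z ℝ) := by
    unfold W S
    congr 1
  have ht : D.Sz j z ⬝ᵥ u = y ⬝ᵥ X.mulVec u := by
    clear_value u
    rw [hS, Matrix.mulVec_transpose, ← Matrix.dotProduct_mulVec]
  have ht' : D.Sz j z ⬝ᵥ u = X.mulVec u ⬝ᵥ X.mulVec u + (D.g ^ 2)⁻¹ * (u ⬝ᵥ u) := by
    rw [← hW, hWX, Matrix.add_mulVec, add_dotProduct, ← Matrix.mulVec_mulVec, Matrix.smul_mulVec,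
      Matrix.one_mulVec, smul_dotProduct, smul_eq_mul, Matrix.mulVec_transpose,
      ← Matrix.dotProduct_mulVec]
  have hjj : D.S j j = y ⬝ᵥ y := by
    simp [S, y, Matrix.mul_apply, dotProduct]
  -- Here `u` is the ridge estimator. Expanding `|y - Xu|² ≥ 0` and inserting `S_{zj}·u = |Xu|² +
  -- g⁻²|u|²` gives `|y|² - S_{zj}·u ≥ g⁻²|u|² ≥ 0`.
  have hsq : 0 ≤ (y - X.mulVec u) ⬝ᵥ (y - X.mulVec u) :=
    Finset.sum_nonneg fun i _ => mul_self_nonneg _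
  have huu : 0 ≤ u ⬝ᵥ u := Finset.sum_nonneg fun i _ => mul_self_nonneg _
  have hc : X.mulVec u ⬝ᵥ y = y ⬝ᵥ X.mulVec u := dotProduct_comm _ _
  rw [sub_dotProduct, dotProduct_sub, dotProduct_sub, hc, ← ht] at hsq
  have hgu : 0 ≤ (D.g ^ 2)⁻¹ * (u ⬝ᵥ u) := by positivity
  rw [hjj]
  linarith

theorem lrWeight_nonneg (hθ0 : 0 < D.θ) (hθ1 : D.θ < 1) (hg : 0 < D.g) (hlam : 0 < D.lam)
    (j : Fin p) (z : Model j) : 0 ≤ D.lrWeight j z := by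
  have hr := D.residual_nonneg hg j z
  have : 0 < 1 - D.θ := sub_pos.mpr hθ1
  unfold lrWeight
  split_ifs
  · refine mul_nonneg (by positivity) (Real.rpow_nonneg (one_div_nonneg.mpr ?_) _)
    linarith
  · exact le_rfl

theorem proposal_nonneg (hθ0 : 0 < D.θ) (hθ1 : D.θ < 1) (hg : 0 < D.g) (hlam : 0 < D.lam)
    {alg : MHAlgorithm} (halg : alg.IsValid) (j : Fin p) (Ω : Matrix (Fin p) (Fin p) ℝ)
    (z z' : Model j) : 0 ≤ D.proposal j Ω alg z z' := by
  cases alg with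
  | bdmh pb pd =>
    obtain ⟨hb, -, hd, -, hs⟩ := halg
    exact bdProposal_nonneg hb.le hd.le hs z z'
  | gimh υ =>
    have h := D.lrWeight_nonneg hθ0 hθ1 hg hlam j
    exact div_nonneg (Real.rpow_nonneg (h _) _)
      (Finset.sum_nonneg fun _ _ => Real.rpow_nonneg (h _) _)
  | lit pb pd lo hi =>
    obtain ⟨hb, -, hd, -, hs, hlo⟩ := halg
    exact litProposal_nonneg hb.le hd.le hs (fun m => (hlo m).1) _ z z'

theorem sum_proposal_le_one {alg : MHAlgorithm} (halg : alg.IsValid) (j : Fin p)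
    (Ω : Matrix (Fin p) (Fin p) ℝ) (z : Model j) : ∑ z', D.proposal j Ω alg z z' ≤ 1 := by
  cases alg with
  | bdmh pb pd =>
    obtain ⟨hb, -, hd, -, hs⟩ := halg
    exact sum_bdProposal_le_one hb.le hd.le hs z
  | gimh υ =>
    simp only [proposal, giProposal]
    rw [← Finset.sum_div]
    exact div_self_le_one _
  | lit pb pd lo hi =>
    obtain ⟨hb, -, hd, -, hs, -⟩ := halg
    exact sum_litProposal_le_one hb.le hd.le hs lo hi _ z

theorem modelProb_nonneg (j : Fin p) (Ω : Matrix (Fin p) (Fin p) ℝ) (z : Model j) :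
    0 ≤ D.modelProb j Ω z :=
  ENNReal.toReal_nonneg

theorem isReversibleChain_condKernel (hθ0 : 0 < D.θ) (hθ1 : D.θ < 1) (hg : 0 < D.g)
    (hlam : 0 < D.lam) {alg : MHAlgorithm} (halg : alg.IsValid) (M : ℕ) (j : Fin p)
    (Ω : Matrix (Fin p) (Fin p) ℝ) :
    IsReversibleChain (D.modelProb j Ω) (D.condKernel alg M j Ω) :=
  (isReversibleChain_mhKernel (D.modelProb_nonneg j Ω)
    (D.proposal_nonneg hθ0 hθ1 hg hlam halg j Ω) (D.sum_proposal_le_one halg j Ω)).pow M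

end Setup

/-! ### Resampling coordinates of a product measure, and mixtures of product measures -/

section ProductMeasures

variable {ι κ : Type*}

theorem measurable_extend {c : κ → ι} (hc : Function.Injective c) :
    Measurable fun q : (ι → ℝ) × (κ → ℝ) => Function.extend c q.2 q.1 := by
  refine measurable_pi_lambda _ fun i => ?_
  by_cases h : ∃ k, c k = i
  · obtain ⟨k, rfl⟩ := h
    simp only [hc.extend_apply]
    exact (measurable_pi_apply k).comp measurable_snd
  · simp only [Function.extend_apply' _ _ _ h]
    exact (measurable_pi_apply i).comp measurable_fst

variable [Fintype ι] [Fintype κ]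

/-- Replacing the coordinates in the range of `c` by independent draws from their laws preserves a
product measure. -/
theorem pi_map_extend (μ : ι → Measure ℝ) [∀ i, IsProbabilityMeasure (μ i)] {c : κ → ι}
    (hc : Function.Injective c) :
    ((Measure.pi μ).prod (Measure.pi fun k => μ (c k))).map
      (fun q => Function.extend c q.2 q.1) = Measure.pi μ := by
  classical
  refine (Measure.pi_eq fun s hs => ?_).symm
  rw [Measure.map_apply (measurable_extend hc) (MeasurableSet.univ_pi hs)]
  -- The preimage of a box is a product of boxes: overwritten coordinates constrain only the new
  -- draw, the others only the old point.
  have hpre : (fun q : (ι → ℝ) × (κ → ℝ) => Function.extend c q.2 q.1) ⁻¹' Set.univ.pi s =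
      (Set.univ.pi fun i => if i ∈ Finset.univ.image c then Set.univ else s i) ×ˢ
        (Set.univ.pi fun k => s (c k)) := by
    ext ⟨x, v⟩
    simp only [Set.mem_preimage, Set.mem_univ_pi, Set.mem_prod]
    constructor
    · intro h
      refine ⟨fun i => ?_, fun k => ?_⟩
      · split_ifs with hi
        · trivial
        · have := h i
          rwa [Function.extend_apply'] at this
          simpa using hi
      · simpa [hc.extend_apply] using h (c k)
    · rintro ⟨h1, h2⟩ i
      by_cases hi : ∃ k, c k = i
      · obtain ⟨k, rfl⟩ := hi
        simpa [hc.extend_apply] using h2 k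
      · rw [Function.extend_apply' _ _ _ hi]
        have := h1 i
        rwa [if_neg (by simpa using hi)] at this
  rw [hpre, Measure.prod_prod, Measure.pi_pi, Measure.pi_pi,
    ← Finset.prod_image (s := Finset.univ) (g := c) (f := fun i => μ i (s i)) (hc.injOn),
    ← Finset.prod_mul_prod_compl (Finset.univ.image c) fun i => μ i (s i),
    ← Finset.prod_mul_prod_compl (Finset.univ.image c) fun i =>
      μ i (if i ∈ Finset.univ.image c then Set.univ else s i)]
  rw [Finset.prod_congr rfl fun i hi => by rw [if_pos hi, measure_univ], Finset.prod_const_one,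
    one_mul, mul_comm]
  congr 1
  exact Finset.prod_congr rfl fun i hi => by rw [if_neg (Finset.mem_compl.mp hi)]

/-- Distributing the product over the sums on boxes: independent spike-or-slab choices amount to a
random graph followed by independent entries. -/
theorem pi_sum_bool [DecidableEq ι] (w : Bool → ℝ≥0∞) (μ : Bool → Measure ℝ)
    [∀ b, IsProbabilityMeasure (μ b)]
    [hx : SigmaFinite (∑ b, w b • μ b)] :
    Measure.pi (fun _ : ι => ∑ b, w b • μ b) =
      ∑ Z : ι → Bool, (∏ i, w (Z i)) • Measure.pi fun i => μ (Z i) := by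
  refine Measure.pi_eq fun s _ => ?_
  simp only [Measure.finsetSum_apply, Measure.smul_apply, Measure.pi_pi, smul_eq_mul,
    Finset.prod_univ_sum, Fintype.piFinset_univ, Finset.prod_mul_distrib]

end ProductMeasures

/-! ### Measurability -/

section Measurability

variable {p : ℕ}

instance matrixBorelSpace (p : ℕ) : BorelSpace (Matrix (Fin p) (Fin p) ℝ) :=
  inferInstanceAs (BorelSpace (Fin p → Fin p → ℝ))

theorem measurable_entry (i k : Fin p) : Measurable fun Ω : Matrix (Fin p) (Fin p) ℝ => Ω i k :=
  (measurable_pi_apply k).comp (measurable_pi_apply (X := fun _ => Fin p → ℝ) i)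

theorem measurable_matrix {α : Type*} [MeasurableSpace α] {f : α → Matrix (Fin p) (Fin p) ℝ}
    (h : ∀ i k, Measurable fun a => f a i k) : Measurable f :=
  measurable_pi_lambda (X := fun _ => Fin p → ℝ) _ fun i => measurable_pi_lambda _ fun k => h i k

theorem measurable_assemble : Measurable (assemble (p := p)) := by
  refine measurable_matrix fun i k => ?_
  unfold assemble
  split_ifs
  · exact (measurable_pi_apply i).comp measurable_fst
  · exact (measurable_pi_apply _).comp measurable_snd

theorem measurable_setColumn (j : Fin p) :
    Measurable fun q : Matrix (Fin p) (Fin p) ℝ × (Fin p → ℝ) => setColumn q.1 j q.2 := by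
  refine measurable_matrix fun i k => ?_
  unfold setColumn
  split_ifs
  · exact (measurable_pi_apply k).comp measurable_snd
  · exact (measurable_pi_apply i).comp measurable_snd
  · exact (measurable_entry i k).comp measurable_fst

theorem measurable_setColumn_right (Ω : Matrix (Fin p) (Fin p) ℝ) (j : Fin p) :
    Measurable (setColumn Ω j) :=
  (measurable_setColumn j).comp measurable_prodMk_left

/-- Positive definite means positive semidefinite with nonzero determinant, so the set is an
intersection of two closed sets and an open one. -/
theorem measurableSet_posDefSet : MeasurableSet (posDefSet p) := by
  have h : posDefSet p = {Ω : Matrix (Fin p) (Fin p) ℝ | Ω.IsHermitian} ∩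
      (⋂ x : Fin p → ℝ, {Ω | 0 ≤ x ⬝ᵥ Ω.mulVec x}) ∩ {Ω | Ω.det ≠ 0} := by
    ext Ω
    simp only [posDefSet, Set.mem_ofPred_eq, Set.mem_inter_iff, Set.mem_iInter]
    constructor
    · intro h
      exact ⟨⟨h.1, fun x => by simpa using h.posSemidef.dotProduct_mulVec_nonneg x⟩, h.det_pos.ne'⟩
    · rintro ⟨⟨h1, h2⟩, h3⟩
      exact (Matrix.PosSemidef.of_dotProduct_mulVec_nonneg h1 fun x => by
        simpa using h2 x).posDef_iff_det_ne_zero.mpr h3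
  rw [h]
  refine ((IsClosed.measurableSet ?_).inter (IsClosed.measurableSet ?_)).inter
    (IsOpen.measurableSet ?_)
  · exact isClosed_eq (by fun_prop) (by fun_prop)
  · exact isClosed_iInter fun x => isClosed_le (by fun_prop) (by fun_prop)
  · exact isOpen_ne_fun (by fun_prop) (by fun_prop)

theorem measurableSet_pattern_eq (j : Fin p) (z : Model j) :
    MeasurableSet {Ω : Matrix (Fin p) (Fin p) ℝ | pattern j Ω = z} := by
  have : {Ω : Matrix (Fin p) (Fin p) ℝ | pattern j Ω = z} =
      ⋂ k : {k : Fin p // k ≠ j}, {Ω | Ω k.1 j ≠ 0 ↔ k ∈ z} := by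
    ext Ω
    simp [pattern, Finset.ext_iff]
  rw [this]
  refine MeasurableSet.iInter fun k => ?_
  have hm : MeasurableSet {Ω : Matrix (Fin p) (Fin p) ℝ | Ω k.1 j ≠ 0} :=
    (measurableSet_eq_fun (measurable_entry _ _) measurable_const).compl
  by_cases hk : k ∈ z
  · simp only [hk, iff_true]
    exact hm
  · simp only [hk, iff_false]
    exact hm.compl

/-- Functions of the matrix and of its edge pattern in a column are measurable if they are so for
each fixed pattern. -/
theorem measurable_pattern_comp {β : Type*} [MeasurableSpace β] (j : Fin p)
    {L : Matrix (Fin p) (Fin p) ℝ → Model j → β} (hL : ∀ z, Measurable fun Ω => L Ω z) :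
    Measurable fun Ω => L Ω (pattern j Ω) := by
  intro s hs
  have : (fun Ω => L Ω (pattern j Ω)) ⁻¹' s =
      ⋃ z : Model j, {Ω | pattern j Ω = z} ∩ (fun Ω => L Ω z) ⁻¹' s := by
    ext Ω
    simp
  rw [this]
  exact MeasurableSet.iUnion fun z => (measurableSet_pattern_eq j z).inter (hL z hs)

namespace Setup

variable {n : ℕ} (D : Setup n p)

theorem measurableSet_feasible : MeasurableSet D.feasible := by
  classical
  have hcard : ∀ i : Fin p, Measurable fun Ω : Matrix (Fin p) (Fin p) ℝ =>
      (Finset.univ.filter fun k => k ≠ i ∧ Ω i k ≠ 0).card := fun i => by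
    simp only [Finset.card_filter]
    refine Finset.measurable_sum _ fun k _ => ?_
    refine Measurable.ite ?_ measurable_const measurable_const
    by_cases hk : k = i
    · simp [hk]
    · simp only [ne_eq, hk, not_false_eq_true, true_and]
      exact (measurableSet_eq_fun (measurable_entry i k) measurable_const).compl
  have : D.feasible = posDefSet p ∩ ⋂ i : Fin p, {Ω |
      (Finset.univ.filter fun k => k ≠ i ∧ Ω i k ≠ 0).card ≤ D.dbar} := by
    ext Ω
    simp only [feasible, posDefSet, Set.mem_ofPred_eq, Set.mem_inter_iff, Set.mem_iInter]
  rw [this]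
  exact measurableSet_posDefSet.inter (MeasurableSet.iInter fun i =>
    measurableSet_le (hcard i) measurable_const)

theorem measurable_likelihood : Measurable D.likelihood := by
  refine ENNReal.measurable_ofReal.comp (Continuous.measurable ?_)
  fun_prop

end Setup

end Measurability

/-! ### Columns -/

section Columns

variable {p : ℕ}

theorem setColumn_setColumn (Ω : Matrix (Fin p) (Fin p) ℝ) (j : Fin p) (v w : Fin p → ℝ) :
    setColumn (setColumn Ω j v) j w = setColumn Ω j w := by
  ext i k
  simp only [setColumn]
  split_ifs <;> rfl

theorem mem_pattern_setColumn (Ω : Matrix (Fin p) (Fin p) ℝ) (j : Fin p) (v : Fin p → ℝ)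
    (k : {k : Fin p // k ≠ j}) : k ∈ pattern j (setColumn Ω j v) ↔ v k.1 ≠ 0 := by
  simp [pattern, setColumn, k.2]

/-- The coordinates of a symmetric matrix (diagonal entries and edges) that lie in column `j`. -/
def columnCoord (j k : Fin p) : Fin p ⊕ Edge p :=
  if h : k = j then .inl j else .inr ⟨s(j, k), fun hd => h (Sym2.mk_isDiag_iff.mp hd).symm⟩

theorem columnCoord_injective (j : Fin p) : Function.Injective (columnCoord j) := by
  intro k l h
  unfold columnCoord at h
  split_ifs at h with h1 h2 h2
  · rw [h1, h2]
  · have h3 : k = l ∨ j = l ∧ k = j := by simpa using h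
    rcases h3 with h3 | ⟨-, h3⟩
    exacts [h3, absurd h3 h1]

/-- In the coordinates by diagonal entries and edges, replacing a column is overwriting the
coordinates in the range of an injective map. This brings the update into the scope of
`pi_map_extend`. -/
theorem assemble_extend (j : Fin p) (x : Fin p ⊕ Edge p → ℝ) (v : Fin p → ℝ) :
    assemble ((fun i => Function.extend (columnCoord j) v x (.inl i)),
      fun e => Function.extend (columnCoord j) v x (.inr e)) =
    setColumn (assemble (fun i => x (.inl i), fun e => x (.inr e))) j v := by
  have hinj := columnCoord_injective j
  ext i k
  by_cases hi : i = j
  · subst hi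
    by_cases hk : i = k
    · subst hk
      have : Sum.inl i = columnCoord i i := by simp [columnCoord]
      simp only [assemble, setColumn, dif_pos, if_pos]
      rw [this, hinj.extend_apply]
    · have : Sum.inr ⟨s(i, k), fun hd => hk (Sym2.mk_isDiag_iff.mp hd)⟩ = columnCoord i k := by
        simp [columnCoord, Ne.symm hk]
      simp only [assemble, setColumn, if_pos, dif_neg hk]
      rw [this, hinj.extend_apply]
  · by_cases hk : k = j
    · subst hk
      have : Sum.inr ⟨s(i, k), fun hd => hi (Sym2.mk_isDiag_iff.mp hd)⟩ = columnCoord k i := by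
        simp only [columnCoord, dif_neg hi]
        congr 2
        exact Sym2.eq_swap
      simp only [assemble, setColumn, dif_neg hi, if_neg hi, if_pos]
      rw [this, hinj.extend_apply]
    · simp only [assemble, setColumn, if_neg hi, if_neg hk]
      split_ifs with hik
      · rw [Function.extend_apply']
        rintro ⟨l, hl⟩
        unfold columnCoord at hl
        split_ifs at hl
        exact hi (Sum.inl.inj hl).symm
      · rw [Function.extend_apply']
        rintro ⟨l, hl⟩
        unfold columnCoord at hl
        split_ifs at hl
        have h3 : s(j, l) = s(i, k) := congrArg Subtype.val (Sum.inr.inj hl)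
        rcases Sym2.eq_iff.mp h3 with ⟨h, -⟩ | ⟨h, -⟩
        · exact hi h.symm
        · exact hk h.symm

end Columns

/-! ### The unconstrained product prior -/

namespace Setup

variable {n p : ℕ} (D : Setup n p)

/-- The positivity assumptions on the prior parameters. -/
structure IsRegular : Prop where
  θ_pos : 0 < D.θ
  θ_lt_one : D.θ < 1
  g_pos : 0 < D.g
  lam_pos : 0 < D.lam

/-- The spike-and-slab mixture, the marginal law of an off-diagonal entry when the positivity and
degree constraints are ignored. -/
def mixLaw : Measure ℝ := ∑ b : Bool, ENNReal.ofReal (if b then D.θ else 1 - D.θ) • D.entryLaw b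

/-- The law of the entries of column `j` when all constraints are ignored. -/
def columnMixLaw (j : Fin p) : Measure (Fin p → ℝ) :=
  Measure.pi fun k => if k = j then D.diagLaw else D.mixLaw

/-- The prior law of `Ω` without positivity and degree constraints. -/
def freePrior : Measure (Matrix (Fin p) (Fin p) ℝ) :=
  ((Measure.pi fun _ : Fin p => D.diagLaw).prod (Measure.pi fun _ : Edge p => D.mixLaw)).map
    assemble

/-- The law of `Ω` given the graph `Z`, without positivity and degree constraints. -/
def freePriorGiven (Z : Edge p → Bool) : Measure (Matrix (Fin p) (Fin p) ℝ) :=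
  ((Measure.pi fun _ : Fin p => D.diagLaw).prod
    (Measure.pi fun e : Edge p => D.entryLaw (Z e))).map assemble

/-- The unnormalised posterior. -/
def posteriorWeight : Measure (Matrix (Fin p) (Fin p) ℝ) :=
  (D.freePrior.restrict D.feasible).withDensity D.likelihood

variable {D}

theorem IsRegular.isProbabilityMeasure_diagLaw (hD : D.IsRegular) :
    IsProbabilityMeasure D.diagLaw :=
  isProbabilityMeasure_expMeasure (half_pos hD.lam_pos)

theorem IsRegular.isProbabilityMeasure_mixLaw (hD : D.IsRegular) :
    IsProbabilityMeasure D.mixLaw := by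
  have h : 0 ≤ 1 - D.θ := sub_nonneg.mpr hD.θ_lt_one.le
  constructor
  simp only [mixLaw, entryLaw, slabLaw, Fintype.sum_bool, Measure.add_apply, Measure.smul_apply,
    if_true, Bool.false_eq_true, if_false, measure_univ, smul_eq_mul, mul_one]
  rw [← ENNReal.ofReal_add hD.θ_pos.le h]
  simp

instance (b : Bool) : IsProbabilityMeasure (D.entryLaw b) := by
  cases b <;> simp only [entryLaw, slabLaw, if_true, Bool.false_eq_true, if_false] <;>
    infer_instance

theorem IsRegular.isProbabilityMeasure_columnLaw (hD : D.IsRegular) (j : Fin p) (z : Model j) :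
    IsProbabilityMeasure (D.columnLaw j z) := by
  have := hD.isProbabilityMeasure_diagLaw
  have : ∀ k : Fin p, IsProbabilityMeasure
      (if h : k = j then D.diagLaw else D.entryLaw (decide (⟨k, h⟩ ∈ z))) := fun k => by
    split_ifs <;> infer_instance
  unfold columnLaw
  infer_instance

theorem IsRegular.isProbabilityMeasure_freePriorGiven (hD : D.IsRegular) (Z : Edge p → Bool) :
    IsProbabilityMeasure (D.freePriorGiven Z) := by
  have := hD.isProbabilityMeasure_diagLaw
  exact Measure.isProbabilityMeasure_map measurable_assemble.aemeasurable

theorem IsRegular.isProbabilityMeasure_freePrior (hD : D.IsRegular) :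
    IsProbabilityMeasure D.freePrior := by
  have := hD.isProbabilityMeasure_diagLaw
  have := hD.isProbabilityMeasure_mixLaw
  exact Measure.isProbabilityMeasure_map measurable_assemble.aemeasurable

/-- An entry drawn from the slab is almost surely nonzero, one drawn from the spike is zero. -/
theorem IsRegular.ae_entryLaw (hD : D.IsRegular) (b : Bool) :
    ∀ᵐ x ∂D.entryLaw b, x ≠ 0 ↔ b = true := by
  cases b
  · simp [entryLaw, ae_dirac_eq]
  · have : NullSingletonClass D.slabLaw := by
      refine nullSingletonClass_gaussianReal ?_
      simpa using hD.g_pos.ne'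
    simp only [entryLaw, if_true, iff_true]
    exact Measure.ae_ne D.slabLaw 0

theorem IsRegular.ae_columnLaw (hD : D.IsRegular) (Ω : Matrix (Fin p) (Fin p) ℝ) (j : Fin p)
    (z : Model j) : ∀ᵐ v ∂D.columnLaw j z, pattern j (setColumn Ω j v) = z := by
  have := hD.isProbabilityMeasure_diagLaw
  have : ∀ k : Fin p, IsProbabilityMeasure
      (if h : k = j then D.diagLaw else D.entryLaw (decide (⟨k, h⟩ ∈ z))) := fun k => by
    split_ifs <;> infer_instance
  have h : ∀ k : {k : Fin p // k ≠ j}, ∀ᵐ v ∂D.columnLaw j z, v k.1 ≠ 0 ↔ k ∈ z := fun k => by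
    refine Measure.tendsto_eval_ae_ae.eventually (p := fun x => x ≠ 0 ↔ k ∈ z) ?_
    rw [dif_neg k.2]
    simpa using hD.ae_entryLaw (decide (k ∈ z))
  filter_upwards [ae_all_iff.mpr h] with v hv
  ext k
  rw [mem_pattern_setColumn, hv]

/-- The column law without constraints is the mixture of the column laws given the patterns. -/
theorem IsRegular.columnMixLaw_eq_sum (hD : D.IsRegular) (j : Fin p) :
    D.columnMixLaw j = ∑ z : Model j,
      ENNReal.ofReal (D.θ ^ z.card * (1 - D.θ) ^ (p - 1 - z.card)) • D.columnLaw j z := by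
  have h1 : 0 ≤ 1 - D.θ := sub_nonneg.mpr hD.θ_lt_one.le
  have := hD.isProbabilityMeasure_diagLaw
  have := hD.isProbabilityMeasure_mixLaw
  have : ∀ k : Fin p, IsProbabilityMeasure (if k = j then D.diagLaw else D.mixLaw) := fun k => by
    split_ifs <;> infer_instance
  have : ∀ (z : Model j) (k : Fin p), IsProbabilityMeasure
      (if h : k = j then D.diagLaw else D.entryLaw (decide (⟨k, h⟩ ∈ z))) := fun z k => by
    split_ifs <;> infer_instance
  refine Measure.pi_eq fun s _ => ?_
  simp only [Measure.finsetSum_apply, Measure.smul_apply, columnLaw, Measure.pi_pi, smul_eq_mul]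
  have hL : ∏ k, (if k = j then D.diagLaw else D.mixLaw) (s k) = D.diagLaw (s j) *
      ∏ k : {k : Fin p // k ≠ j}, (ENNReal.ofReal D.θ * D.entryLaw true (s k.1) +
        ENNReal.ofReal (1 - D.θ) * D.entryLaw false (s k.1)) := by
    rw [Fintype.prod_eq_mul_prod_subtype_ne _ j, if_pos rfl]
    congr 1
    refine Finset.prod_congr rfl fun k _ => ?_
    rw [if_neg k.2]
    simp [mixLaw]
  -- Expanding the product of slab-plus-spike terms gives a sum over subsets, and these subsets are
  -- the edge patterns.
  rw [hL, Fintype.prod_add, Finset.mul_sum]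
  refine Finset.sum_congr rfl fun z _ => ?_
  rw [Fintype.prod_eq_mul_prod_subtype_ne _ j, dif_pos rfl, mul_left_comm]
  congr 1
  rw [ENNReal.ofReal_mul (pow_nonneg hD.θ_pos.le _), ENNReal.ofReal_pow hD.θ_pos.le,
    ENNReal.ofReal_pow h1]
  simp only [Finset.prod_mul_distrib, Finset.prod_const, Finset.card_compl, card_ne_eq]
  rw [← Finset.prod_mul_prod_compl z fun k : {k : Fin p // k ≠ j} =>
    (if h : k.1 = j then D.diagLaw else D.entryLaw (decide (⟨k.1, h⟩ ∈ z))) (s k.1)]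
  rw [Finset.prod_congr (s₁ := z) rfl fun k hk => by
      rw [dif_neg k.2, Subtype.coe_eta, decide_eq_true hk],
    Finset.prod_congr (s₁ := zᶜ) rfl fun k hk => by
      rw [dif_neg k.2, Subtype.coe_eta, decide_eq_false (Finset.mem_compl.mp hk)]]
  ring

/-- Replacing a column by an independent draw preserves the unconstrained prior. -/
theorem IsRegular.freePrior_map_setColumn (hD : D.IsRegular) (j : Fin p) :
    (D.freePrior.prod (D.columnMixLaw j)).map (fun q => setColumn q.1 j q.2) = D.freePrior := by
  have := hD.isProbabilityMeasure_diagLaw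
  have := hD.isProbabilityMeasure_mixLaw
  -- Diagonal entries and edges are put into one index type, so that a column, which meets both, is
  -- a single family of coordinates.
  let μ : Fin p ⊕ Edge p → Measure ℝ := Sum.elim (fun _ => D.diagLaw) (fun _ => D.mixLaw)
  have hμ : ∀ i, IsProbabilityMeasure (μ i) := by
    rintro (i | e) <;> simp only [μ, Sum.elim_inl, Sum.elim_inr] <;> infer_instance
  let A : (Fin p ⊕ Edge p → ℝ) → Matrix (Fin p) (Fin p) ℝ := fun x =>
    assemble (fun i => x (.inl i), fun e => x (.inr e))
  have hA : Measurable A := measurable_assemble.comp (by fun_prop)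
  have hfree : D.freePrior = (Measure.pi μ).map A := by
    have h := (measurePreserving_sumPiEquivProdPi (X := fun _ => ℝ) μ).map_eq
    have h' := congrArg (Measure.map assemble) h
    rw [Measure.map_map measurable_assemble (MeasurableEquiv.measurable _)] at h'
    exact h'.symm
  have hcol : D.columnMixLaw j = Measure.pi fun k => μ (columnCoord j k) := by
    unfold columnMixLaw
    congr 1
    funext k
    unfold columnCoord
    split_ifs <;> rfl
  conv_rhs => rw [hfree, ← pi_map_extend μ (columnCoord_injective j),
    Measure.map_map hA (measurable_extend (columnCoord_injective j))]
  have hprod : D.freePrior.prod (D.columnMixLaw j) =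
      ((Measure.pi μ).prod (D.columnMixLaw j)).map (Prod.map A id) := by
    rw [hcol, hfree]
    conv_lhs => rw [← Measure.map_id (μ := Measure.pi fun k => μ (columnCoord j k))]
    exact Measure.map_prod_map _ _ hA measurable_id
  rw [hprod, Measure.map_map (measurable_setColumn j) (hA.prodMap measurable_id), ← hcol]
  congr 1
  funext q
  exact (assemble_extend j q.1 q.2).symm

/-- The unconstrained prior is the mixture of its versions given the graph. -/
theorem IsRegular.freePrior_eq_sum (hD : D.IsRegular) :
    D.freePrior = ∑ Z : Edge p → Bool,
      ENNReal.ofReal (∏ e, if Z e then D.θ else 1 - D.θ) • D.freePriorGiven Z := by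
  have h1 : 0 ≤ 1 - D.θ := sub_nonneg.mpr hD.θ_lt_one.le
  have := hD.isProbabilityMeasure_diagLaw
  have := hD.isProbabilityMeasure_mixLaw
  have hpi := pi_sum_bool (ι := Edge p) (fun b => ENNReal.ofReal (if b then D.θ else 1 - D.θ))
    D.entryLaw (hx := (inferInstance : SigmaFinite D.mixLaw))
  unfold freePrior
  rw [show (fun _ : Edge p => D.mixLaw) = fun _ =>
    ∑ b : Bool, ENNReal.ofReal (if b then D.θ else 1 - D.θ) • D.entryLaw b from rfl, hpi,
    ← Measure.sum_fintype, Measure.prod_sum_right, Measure.map_sum measurable_assemble.aemeasurable,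
    Measure.sum_fintype]
  refine Finset.sum_congr rfl fun Z _ => ?_
  rw [Measure.prod_smul_right, Measure.map_smul, ENNReal.ofReal_prod_of_nonneg fun e _ => by
    split_ifs; exacts [hD.θ_pos.le, h1]]
  rfl

end Setup

section Normalize

variable {α : Type*} [MeasurableSpace α]

theorem normalize_univ {μ : Measure α} (h0 : μ Set.univ ≠ 0) (ht : μ Set.univ ≠ ∞) :
    normalize μ Set.univ = 1 := by
  rw [normalize, Measure.smul_apply, smul_eq_mul, ENNReal.inv_mul_cancel h0 ht]

theorem normalize_of_univ_eq_top {μ : Measure α} (h : μ Set.univ = ∞) : normalize μ = 0 := by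
  rw [normalize, h, ENNReal.inv_top, zero_smul]

theorem normalize_zero : normalize (0 : Measure α) = 0 := by
  rw [normalize, smul_zero]

end Normalize

/-! ### The posterior as a reweighted product measure -/

namespace Setup

variable {n p : ℕ} {D : Setup n p}

open Classical in
-- The degree constraint appears twice, on the graph in the prior and on the nonzero entries in
-- `feasible`. The bijection sends a neighbour `k` of `i` to the edge `{i, k}`.
theorem degree_eq_of_support (Ω : Matrix (Fin p) (Fin p) ℝ) (Z : Edge p → Bool)
    (h : ∀ (i k : Fin p) (hik : i ≠ k),
      Ω i k ≠ 0 ↔ Z ⟨s(i, k), fun hd => hik (Sym2.mk_isDiag_iff.mp hd)⟩ = true) (i : Fin p) :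
    (Finset.univ.filter fun k => k ≠ i ∧ Ω i k ≠ 0).card =
      (Finset.univ.filter fun e : Edge p => Z e = true ∧ i ∈ e.1).card := by
  refine Finset.card_bij' (fun k hk => ⟨s(i, k), fun hd =>
      (Finset.mem_filter.mp hk).2.1 (Sym2.mk_isDiag_iff.mp hd).symm⟩)
    (fun e he => Sym2.Mem.other (Finset.mem_filter.mp he).2.2) ?_ ?_ ?_ ?_
  · intro k hk
    obtain ⟨-, hki, hk0⟩ := Finset.mem_filter.mp hk
    refine Finset.mem_filter.mpr ⟨Finset.mem_univ _, (h i k (Ne.symm hki)).mp hk0, ?_⟩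
    exact Sym2.mem_mk_left i k
  · intro e he
    obtain ⟨-, hZ, hie⟩ := Finset.mem_filter.mp he
    have hs : s(i, Sym2.Mem.other hie) = e.1 := Sym2.other_spec hie
    have hne : i ≠ Sym2.Mem.other hie := fun h' =>
      e.2 (by rw [← hs]; exact Sym2.mk_isDiag_iff.mpr h')
    refine Finset.mem_filter.mpr ⟨Finset.mem_univ _, hne.symm, (h _ _ hne).mpr ?_⟩
    convert hZ
  · intro k hk
    exact Sym2.congr_right.mp (Sym2.other_spec (Sym2.mem_mk_left i k))
  · intro e he
    exact Subtype.ext (Sym2.other_spec (Finset.mem_filter.mp he).2.2)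

/-- The slab has no atom at `0`, so the graph can be read off the matrix almost surely. -/
theorem IsRegular.ae_freePriorGiven_support (hD : D.IsRegular) (Z : Edge p → Bool) :
    ∀ᵐ x ∂(Measure.pi fun _ : Fin p => D.diagLaw).prod (Measure.pi fun e => D.entryLaw (Z e)),
      ∀ (i k : Fin p) (hik : i ≠ k), assemble x i k ≠ 0 ↔
        Z ⟨s(i, k), fun hd => hik (Sym2.mk_isDiag_iff.mp hd)⟩ = true := by
  have := hD.isProbabilityMeasure_diagLaw
  have h : ∀ e : Edge p, ∀ᵐ x ∂(Measure.pi fun _ : Fin p => D.diagLaw).prod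
      (Measure.pi fun e => D.entryLaw (Z e)), x.2 e ≠ 0 ↔ Z e = true := fun e =>
    Measure.quasiMeasurePreserving_snd.ae
      (p := fun y : Edge p → ℝ => y e ≠ 0 ↔ Z e = true)
      (Measure.tendsto_eval_ae_ae.eventually (p := fun t => t ≠ 0 ↔ Z e = true)
        (hD.ae_entryLaw (Z e)))
  filter_upwards [ae_all_iff.mpr h] with x hx i k hik
  rw [assemble, dif_neg hik]
  exact hx _

open Classical in
-- Given `Z`, the support of the matrix is almost surely `Z`, so the degree constraint either always
-- holds, leaving only positivity, or always fails.
theorem IsRegular.freePriorGiven_restrict_feasible (hD : D.IsRegular) (Z : Edge p → Bool) :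
    (D.freePriorGiven Z).restrict D.feasible =
      if ∀ i : Fin p, (Finset.univ.filter fun e : Edge p => Z e = true ∧ i ∈ e.1).card ≤ D.dbar
      then D.unnormalizedPriorGiven Z else 0 := by
  have hmeas := measurable_assemble (p := p)
  have hfun : ∀ {s t : Set (Matrix (Fin p) (Fin p) ℝ)}, MeasurableSet s → MeasurableSet t →
      (∀ x : (Fin p → ℝ) × (Edge p → ℝ), (∀ (i k : Fin p) (hik : i ≠ k), assemble x i k ≠ 0 ↔
        Z ⟨s(i, k), fun hd => hik (Sym2.mk_isDiag_iff.mp hd)⟩ = true) →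
        (assemble x ∈ s ↔ assemble x ∈ t)) →
      (D.freePriorGiven Z).restrict s = (D.freePriorGiven Z).restrict t := by
    intro s t hs ht hst
    refine Measure.restrict_congr_set (Filter.eventuallyEq_set.mpr ?_)
    refine (ae_map_iff hmeas.aemeasurable ?_).mpr ?_
    · have : {x | x ∈ s ↔ x ∈ t} = (symmDiff s t)ᶜ := by
        ext x
        simp only [Set.mem_ofPred_eq, Set.mem_compl_iff, Set.mem_symmDiff]
        tauto
      rw [this]
      exact (hs.symmDiff ht).compl
    · filter_upwards [hD.ae_freePriorGiven_support Z] with x hx using hst x hx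
  split_ifs with hdeg
  · refine hfun D.measurableSet_feasible measurableSet_posDefSet fun x hx => ?_
    refine ⟨fun h => h.1, fun h => ⟨h, fun i => ?_⟩⟩
    rw [degree_eq_of_support _ Z hx]
    exact hdeg i
  · rw [hfun D.measurableSet_feasible MeasurableSet.empty fun x hx => ?_, Measure.restrict_empty]
    refine iff_of_false (fun h => hdeg fun i => ?_) (Set.notMem_empty _)
    rw [← degree_eq_of_support _ Z hx]
    exact h.2 i

/-- The weight of a graph carries `C₁(Z)⁻¹`, which cancels the normalisation of `π(Ω | Z)`. What
remains is a mixture of product laws, hence one product law, under the constraints. -/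
theorem IsRegular.prior_eq (hD : D.IsRegular) :
    D.prior = (∑ Z, D.graphWeight Z)⁻¹ • D.freePrior.restrict D.feasible := by
  classical
  rw [hD.freePrior_eq_sum, ← Measure.sum_fintype, Measure.restrict_sum _ D.measurableSet_feasible,
    Measure.sum_fintype, prior, Finset.smul_sum]
  refine Finset.sum_congr rfl fun Z _ => ?_
  rw [Measure.restrict_smul, hD.freePriorGiven_restrict_feasible Z, ENNReal.div_eq_inv_mul,
    mul_smul]
  congr 1
  unfold graphWeight
  split_ifs with h
  · have := hD.isProbabilityMeasure_freePriorGiven Z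
    have ht : D.unnormalizedPriorGiven Z Set.univ ≠ ∞ := by
      refine ((Measure.restrict_apply_le _ _).trans_lt
        (measure_lt_top (D.freePriorGiven Z) Set.univ)).ne
    rw [C₁, inv_inv, priorGiven, normalize, mul_comm]
    -- The cancellation needs nonzero mass; a graph of zero mass contributes the zero measure to
    -- both sides.
    by_cases h0 : D.unnormalizedPriorGiven Z Set.univ = 0
    · rw [Measure.measure_univ_eq_zero.mp h0, smul_zero, smul_zero, smul_zero]
    · rw [smul_smul, mul_assoc, ENNReal.mul_inv_cancel h0 ht, mul_one]
  · simp

/-- The posterior is a probability measure proportional to `posteriorWeight`, unless it is zero. -/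
theorem IsRegular.posterior_eq_zero_or (hD : D.IsRegular) :
    D.posterior = 0 ∨ IsProbabilityMeasure D.posterior ∧ D.posteriorWeight Set.univ ≠ ∞ ∧
      ∃ a : ℝ≥0∞, D.posterior = a • D.posteriorWeight := by
  set c := (∑ Z, D.graphWeight Z)⁻¹
  have hpost : D.posterior = normalize (c • D.posteriorWeight) := by
    rw [posterior, hD.prior_eq, withDensity_smul_measure, posteriorWeight]
  by_cases h0 : (c • D.posteriorWeight) Set.univ = 0
  · left
    rw [hpost, Measure.measure_univ_eq_zero.mp h0, normalize_zero]
  by_cases ht : (c • D.posteriorWeight) Set.univ = ∞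
  · left
    rw [hpost, normalize_of_univ_eq_top ht]
  right
  refine ⟨⟨by rw [hpost, normalize_univ h0 ht]⟩, fun h => ?_, _, by
    rw [hpost, normalize, smul_smul]⟩
  rw [Measure.smul_apply, smul_eq_mul] at h0 ht
  rw [h] at ht
  exact ht (ENNReal.mul_top (left_ne_zero_of_mul h0))

/-! ### The conditional laws of a column -/

variable (D) in
/-- The mass `π(Ω_{-j-j} | Y)` of the full conditional of column `j`, up to a constant. -/
def columnMass (j : Fin p) (Ω : Matrix (Fin p) (Fin p) ℝ) : ℝ≥0∞ :=
  ∑ z, D.columnJoint j Ω z Set.univ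

/-- A second replacement of the column erases the first. All conditional objects below inherit this
dependence on `Ω_{-j-j}` alone, which lets them be pulled out of integrals over the column. -/
theorem columnJoint_setColumn (j : Fin p) (Ω : Matrix (Fin p) (Fin p) ℝ) (v : Fin p → ℝ)
    (z : Model j) : D.columnJoint j (setColumn Ω j v) z = D.columnJoint j Ω z := by
  unfold columnJoint
  congr 4
  funext w
  exact setColumn_setColumn Ω j v w

theorem columnGiven_setColumn (j : Fin p) (Ω : Matrix (Fin p) (Fin p) ℝ) (v : Fin p → ℝ)
    (z : Model j) : D.columnGiven j (setColumn Ω j v) z = D.columnGiven j Ω z := by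
  rw [columnGiven, columnJoint_setColumn, columnGiven]

theorem columnMass_setColumn (j : Fin p) (Ω : Matrix (Fin p) (Fin p) ℝ) (v : Fin p → ℝ) :
    D.columnMass j (setColumn Ω j v) = D.columnMass j Ω := by
  simp only [columnMass, columnJoint_setColumn]

theorem modelProb_setColumn (j : Fin p) (Ω : Matrix (Fin p) (Fin p) ℝ) (v : Fin p → ℝ) :
    D.modelProb j (setColumn Ω j v) = D.modelProb j Ω := by
  funext z
  simp only [modelProb, columnJoint_setColumn]

theorem proposal_setColumn (alg : MHAlgorithm) (j : Fin p) (Ω : Matrix (Fin p) (Fin p) ℝ)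
    (v : Fin p → ℝ) : D.proposal j (setColumn Ω j v) alg = D.proposal j Ω alg := by
  cases alg <;> simp only [proposal, modelProb_setColumn]

theorem condKernel_setColumn (alg : MHAlgorithm) (M : ℕ) (j : Fin p)
    (Ω : Matrix (Fin p) (Fin p) ℝ) (v : Fin p → ℝ) :
    D.condKernel alg M j (setColumn Ω j v) = D.condKernel alg M j Ω := by
  rw [condKernel, modelProb_setColumn, proposal_setColumn, condKernel]

theorem gibbsColumn_setColumn (j : Fin p) (Ω : Matrix (Fin p) (Fin p) ℝ) (v : Fin p → ℝ) :
    D.gibbsColumn j (setColumn Ω j v) = D.gibbsColumn j Ω := by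
  simp only [gibbsColumn, modelProb_setColumn, columnGiven_setColumn]

theorem lintegral_columnJoint (j : Fin p) (Ω : Matrix (Fin p) (Fin p) ℝ) (z : Model j)
    {F : Matrix (Fin p) (Fin p) ℝ → ℝ≥0∞} (hF : Measurable F) :
    ∫⁻ Ω', F Ω' ∂D.columnJoint j Ω z =
      ENNReal.ofReal (D.θ ^ z.card * (1 - D.θ) ^ (p - 1 - z.card)) *
        ∫⁻ v, D.feasible.indicator (fun Ω' => D.likelihood Ω' * F Ω') (setColumn Ω j v)
          ∂D.columnLaw j z := by
  have hmul : Measurable (D.likelihood * F) := D.measurable_likelihood.mul hF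
  rw [columnJoint, lintegral_smul_measure, smul_eq_mul,
    lintegral_withDensity_eq_lintegral_mul _ D.measurable_likelihood hF,
    ← lintegral_indicator D.measurableSet_feasible,
    lintegral_map (hmul.indicator D.measurableSet_feasible) (measurable_setColumn_right Ω j)]
  rfl

/-- Integrals over `Ω_{·j}` given `z` only see matrices that agree with `Ω` off column `j` and
have pattern `z` in column `j`. -/
theorem IsRegular.lintegral_columnJoint_congr (hD : D.IsRegular) (j : Fin p)
    (Ω : Matrix (Fin p) (Fin p) ℝ) (z : Model j) {F G : Matrix (Fin p) (Fin p) ℝ → ℝ≥0∞}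
    (hF : Measurable F) (hG : Measurable G)
    (h : ∀ v, pattern j (setColumn Ω j v) = z → F (setColumn Ω j v) = G (setColumn Ω j v)) :
    ∫⁻ Ω', F Ω' ∂D.columnJoint j Ω z = ∫⁻ Ω', G Ω' ∂D.columnJoint j Ω z := by
  rw [lintegral_columnJoint j Ω z hF, lintegral_columnJoint j Ω z hG]
  congr 1
  refine lintegral_congr_ae ?_
  filter_upwards [hD.ae_columnLaw Ω j z] with v hv
  simp only [Set.indicator, h v hv]

theorem IsRegular.measurable_lintegral_columnJoint (hD : D.IsRegular) (j : Fin p) (z : Model j)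
    {F : Matrix (Fin p) (Fin p) ℝ → ℝ≥0∞} (hF : Measurable F) :
    Measurable fun Ω => ∫⁻ Ω', F Ω' ∂D.columnJoint j Ω z := by
  have := hD.isProbabilityMeasure_columnLaw j z
  simp only [lintegral_columnJoint j _ z hF]
  refine Measurable.const_mul (Measurable.lintegral_prod_right' (f := fun q =>
    D.feasible.indicator (fun Ω' => D.likelihood Ω' * F Ω') (setColumn q.1 j q.2)) ?_) _
  exact ((D.measurable_likelihood.mul hF).indicator D.measurableSet_feasible).comp
    (measurable_setColumn j)

theorem IsRegular.measurable_columnJoint_apply (hD : D.IsRegular) (j : Fin p) (z : Model j)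
    {A : Set (Matrix (Fin p) (Fin p) ℝ)} (hA : MeasurableSet A) :
    Measurable fun Ω => D.columnJoint j Ω z A := by
  simpa only [lintegral_indicator_one hA] using
    hD.measurable_lintegral_columnJoint j z (measurable_one.indicator hA)

theorem IsRegular.measurable_columnMass (hD : D.IsRegular) (j : Fin p) :
    Measurable (D.columnMass j) :=
  Finset.measurable_sum _ fun z _ => hD.measurable_columnJoint_apply j z MeasurableSet.univ

theorem IsRegular.measurable_modelProb (hD : D.IsRegular) (j : Fin p) (z : Model j) :
    Measurable fun Ω => D.modelProb j Ω z :=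
  ((hD.measurable_columnJoint_apply j z MeasurableSet.univ).div
    (hD.measurable_columnMass j)).ennreal_toReal

theorem IsRegular.measurable_columnGiven_apply (hD : D.IsRegular) (j : Fin p) (z : Model j)
    {A : Set (Matrix (Fin p) (Fin p) ℝ)} (hA : MeasurableSet A) :
    Measurable fun Ω => D.columnGiven j Ω z A := by
  simp only [columnGiven, normalize, Measure.smul_apply, smul_eq_mul]
  exact (hD.measurable_columnJoint_apply j z MeasurableSet.univ).inv.mul
    (hD.measurable_columnJoint_apply j z hA)

theorem measurable_mhKernel {α ι : Type*} [MeasurableSpace α] [Fintype ι] [DecidableEq ι]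
    {π : α → ι → ℝ} {Q : α → Matrix ι ι ℝ} (hπ : ∀ x, Measurable fun a => π a x)
    (hQ : ∀ x y, Measurable fun a => Q a x y) (x y : ι) :
    Measurable fun a => mhKernel (π a) (Q a) x y := by
  have hacc : ∀ x y, Measurable fun a => acceptProb (π a) (Q a) x y := fun x y =>
    measurable_const.min (((hπ y).mul (hQ y x)).div ((hπ x).mul (hQ x y)))
  unfold mhKernel
  refine ((hacc x y).mul (hQ x y)).add ?_
  split_ifs
  · exact measurable_const.sub (Finset.measurable_sum _ fun w _ => (hQ x w).mul (hacc x w))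
  · exact measurable_const

theorem measurable_matrix_pow {α ι : Type*} [MeasurableSpace α] [Fintype ι] [DecidableEq ι]
    {K : α → Matrix ι ι ℝ} (hK : ∀ x y, Measurable fun a => K a x y) (m : ℕ) (x y : ι) :
    Measurable fun a => (K a ^ m) x y := by
  induction m generalizing y with
  | zero => simpa only [pow_zero] using measurable_const
  | succ m ih =>
    simp only [pow_succ, Matrix.mul_apply]
    exact Finset.measurable_sum _ fun w _ => (ih w).mul (hK w y)

theorem IsRegular.measurable_proposal (hD : D.IsRegular) (alg : MHAlgorithm) (j : Fin p)
    (z z' : Model j) : Measurable fun Ω => D.proposal j Ω alg z z' := by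
  cases alg with
  | bdmh pb pd => exact measurable_const
  | gimh υ => exact measurable_const
  | lit pb pd lo hi =>
    have hw : ∀ (m : Move) (z z' : Model j), Measurable fun Ω =>
        max (lo m) (min (D.modelProb j Ω z' / D.modelProb j Ω z) (hi m)) := fun m z z' =>
      measurable_const.max (((hD.measurable_modelProb j z').div
        (hD.measurable_modelProb j z)).min measurable_const)
    have hq : ∀ m : Move, Measurable fun Ω => if z' ∈ m.nbhd z then m.prob pb pd *
        max (lo m) (min (D.modelProb j Ω z' / D.modelProb j Ω z) (hi m)) /
          ∑ z'' ∈ m.nbhd z, max (lo m) (min (D.modelProb j Ω z'' / D.modelProb j Ω z) (hi m))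
        else 0 := fun m => by
      split_ifs
      · exact (measurable_const.mul (hw m z z')).div
          (Finset.measurable_sum _ fun z'' _ => hw m z z'')
      · exact measurable_const
    exact ((hq .birth).add (hq .death)).add (hq .swap)

theorem IsRegular.measurable_condKernel (hD : D.IsRegular) (alg : MHAlgorithm) (M : ℕ) (j : Fin p)
    (z z' : Model j) : Measurable fun Ω => D.condKernel alg M j Ω z z' :=
  measurable_matrix_pow (measurable_mhKernel (hD.measurable_modelProb j)
    (hD.measurable_proposal alg j)) M z z'

/-! ### Disintegration of the posterior along a column -/

/-- Under the unconstrained prior, column `j` may be replaced by an independent draw, whose law is a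
mixture over patterns. Likelihood and constraints are then part of the integrand, and together they
form `columnJoint`. -/
theorem IsRegular.lintegral_posteriorWeight (hD : D.IsRegular) (j : Fin p)
    {F : Matrix (Fin p) (Fin p) ℝ → ℝ≥0∞} (hF : Measurable F) :
    ∫⁻ Ω, F Ω ∂D.posteriorWeight =
      ∫⁻ Ω, ∑ z, ∫⁻ Ω', F Ω' ∂D.columnJoint j Ω z ∂D.freePrior := by
  have hmul : Measurable fun Ω' => D.likelihood Ω' * F Ω' := D.measurable_likelihood.mul hF
  have hind := hmul.indicator D.measurableSet_feasible
  have := hD.isProbabilityMeasure_freePrior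
  have : IsProbabilityMeasure (D.columnMixLaw j) := by
    have := hD.isProbabilityMeasure_diagLaw
    have := hD.isProbabilityMeasure_mixLaw
    have : ∀ k : Fin p, IsProbabilityMeasure (if k = j then D.diagLaw else D.mixLaw) := fun k => by
      split_ifs <;> infer_instance
    unfold columnMixLaw
    infer_instance
  rw [posteriorWeight, lintegral_withDensity_eq_lintegral_mul _ D.measurable_likelihood hF,
    ← lintegral_indicator D.measurableSet_feasible]
  conv_lhs => rw [← hD.freePrior_map_setColumn j]
  change ∫⁻ Ω, D.feasible.indicator (fun Ω' => D.likelihood Ω' * F Ω') Ω ∂_ = _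
  rw [lintegral_map hind (measurable_setColumn j),
    lintegral_prod (fun q : Matrix (Fin p) (Fin p) ℝ × (Fin p → ℝ) =>
      D.feasible.indicator (fun Ω' => D.likelihood Ω' * F Ω') (setColumn q.1 j q.2))
      (hind.comp (measurable_setColumn j)).aemeasurable]
  refine lintegral_congr fun Ω => ?_
  rw [hD.columnMixLaw_eq_sum j, lintegral_finsetSum_measure]
  refine Finset.sum_congr rfl fun z _ => ?_
  rw [lintegral_smul_measure, smul_eq_mul, lintegral_columnJoint j Ω z hF]

/-- Functions of `Ω_{-j-j}` factor out of integrals over column `j`. -/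
theorem IsRegular.lintegral_posteriorWeight_of_invariant (hD : D.IsRegular) (j : Fin p)
    {F : Matrix (Fin p) (Fin p) ℝ → ℝ≥0∞} (hF : Measurable F)
    (hinv : ∀ Ω v, F (setColumn Ω j v) = F Ω) :
    ∫⁻ Ω, F Ω ∂D.posteriorWeight = ∫⁻ Ω, F Ω * D.columnMass j Ω ∂D.freePrior := by
  rw [hD.lintegral_posteriorWeight j hF]
  refine lintegral_congr fun Ω => ?_
  rw [columnMass, Finset.mul_sum]
  refine Finset.sum_congr rfl fun z _ => ?_
  rw [hD.lintegral_columnJoint_congr j Ω z hF (measurable_const (a := F Ω)) fun v _ => hinv Ω v,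
    lintegral_const]

theorem IsRegular.ae_columnMass_ne_top (hD : D.IsRegular) (j : Fin p)
    (hfin : D.posteriorWeight Set.univ ≠ ∞) : ∀ᵐ Ω ∂D.freePrior, D.columnMass j Ω ≠ ∞ := by
  have h := hD.lintegral_posteriorWeight_of_invariant j measurable_one fun _ _ => rfl
  simp only [Pi.one_apply, lintegral_one, one_mul] at h
  filter_upwards [ae_lt_top (hD.measurable_columnMass j) (h ▸ hfin)] with Ω hΩ using hΩ.ne

theorem IsRegular.ae_posteriorWeight_columnMass (hD : D.IsRegular) (j : Fin p)
    (hfin : D.posteriorWeight Set.univ ≠ ∞) :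
    ∀ᵐ Ω ∂D.posteriorWeight, D.columnMass j Ω ≠ 0 ∧ D.columnMass j Ω ≠ ∞ := by
  have hT := hD.measurable_columnMass j
  have hS : MeasurableSet {Ω | D.columnMass j Ω ≠ 0 ∧ D.columnMass j Ω ≠ ∞}ᶜ :=
    ((measurableSet_eq_fun hT measurable_const).compl.inter
      (measurableSet_eq_fun hT measurable_const).compl).compl
  rw [ae_iff]
  change D.posteriorWeight {Ω | D.columnMass j Ω ≠ 0 ∧ D.columnMass j Ω ≠ ∞}ᶜ = 0
  rw [← lintegral_indicator_one hS,
    hD.lintegral_posteriorWeight_of_invariant j (measurable_one.indicator hS) fun Ω v => by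
      simp only [Set.indicator, Set.mem_compl_iff, Set.mem_ofPred_eq, columnMass_setColumn]
      rfl]
  -- Infinite column mass is null under `freePrior`, and where the mass is `0` the factor
  -- `columnMass` kills the integrand.
  refine (lintegral_congr_ae ?_).trans lintegral_zero
  filter_upwards [hD.ae_columnMass_ne_top j hfin] with Ω hΩ
  by_cases h0 : D.columnMass j Ω = 0
  · rw [h0, mul_zero]
  · rw [Set.indicator_of_notMem (by simp [h0, hΩ]), zero_mul]

theorem columnJoint_univ_ne_top {j : Fin p} {Ω : Matrix (Fin p) (Fin p) ℝ}
    (ht : D.columnMass j Ω ≠ ∞) (z : Model j) : D.columnJoint j Ω z Set.univ ≠ ∞ :=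
  ((Finset.single_le_sum (f := fun z => D.columnJoint j Ω z Set.univ) (fun _ _ => zero_le)
    (Finset.mem_univ z)).trans_lt (lt_top_iff_ne_top.mpr ht)).ne

theorem ofReal_modelProb {j : Fin p} {Ω : Matrix (Fin p) (Fin p) ℝ}
    (h0 : D.columnMass j Ω ≠ 0) (ht : D.columnMass j Ω ≠ ∞) (z : Model j) :
    ENNReal.ofReal (D.modelProb j Ω z) = D.columnJoint j Ω z Set.univ / D.columnMass j Ω :=
  ENNReal.ofReal_toReal (ENNReal.div_ne_top (columnJoint_univ_ne_top ht z) h0)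

theorem lintegral_gibbsColumn (j : Fin p) (Ω : Matrix (Fin p) (Fin p) ℝ)
    (h0 : D.columnMass j Ω ≠ 0) (ht : D.columnMass j Ω ≠ ∞)
    (F : Matrix (Fin p) (Fin p) ℝ → ℝ≥0∞) :
    ∫⁻ Ω', F Ω' ∂D.gibbsColumn j Ω =
      (D.columnMass j Ω)⁻¹ * ∑ z, ∫⁻ Ω', F Ω' ∂D.columnJoint j Ω z := by
  rw [gibbsColumn, lintegral_finsetSum_measure, Finset.mul_sum]
  refine Finset.sum_congr rfl fun z _ => ?_
  have hz := columnJoint_univ_ne_top ht z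
  rw [columnGiven, normalize, lintegral_smul_measure, lintegral_smul_measure,
    ofReal_modelProb h0 ht]
  by_cases hz0 : D.columnJoint j Ω z Set.univ = 0
  · rw [Measure.measure_univ_eq_zero.mp hz0]
    simp
  · rw [smul_eq_mul, smul_eq_mul, ENNReal.div_eq_inv_mul, mul_assoc, ← mul_assoc _ _⁻¹,
      ENNReal.mul_inv_cancel hz0 hz, one_mul]

/-- The exact update of column `j` leaves the posterior invariant. -/
theorem IsRegular.lintegral_gibbsColumn_posteriorWeight (hD : D.IsRegular) (j : Fin p)
    (hfin : D.posteriorWeight Set.univ ≠ ∞)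
    {F : Matrix (Fin p) (Fin p) ℝ → ℝ≥0∞} (hF : Measurable F) :
    ∫⁻ Ω, F Ω ∂D.posteriorWeight =
      ∫⁻ Ω, ∫⁻ Ω', F Ω' ∂D.gibbsColumn j Ω ∂D.posteriorWeight := by
  have hmeas : Measurable fun Ω => ∫⁻ Ω', F Ω' ∂D.gibbsColumn j Ω := by
    simp only [gibbsColumn, lintegral_finsetSum_measure, lintegral_smul_measure, columnGiven,
      normalize]
    refine Finset.measurable_sum _ fun z _ => ?_
    exact (hD.measurable_modelProb j z).ennreal_ofReal.mul
      ((hD.measurable_columnJoint_apply j z MeasurableSet.univ).inv.mul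
        (hD.measurable_lintegral_columnJoint j z hF))
  -- The inner integral depends on `Ω_{-j-j}` only, so disintegration multiplies it by `columnMass`,
  -- which cancels the normaliser of the exact update.
  rw [hD.lintegral_posteriorWeight_of_invariant j hmeas fun Ω v => by rw [gibbsColumn_setColumn],
    hD.lintegral_posteriorWeight j hF]
  refine lintegral_congr_ae ?_
  filter_upwards [hD.ae_columnMass_ne_top j hfin] with Ω ht
  by_cases h0 : D.columnMass j Ω = 0
  · rw [h0, mul_zero]
    refine Finset.sum_eq_zero fun z _ => ?_
    rw [Measure.measure_univ_eq_zero.mp (Finset.sum_eq_zero_iff.mp h0 z (Finset.mem_univ z)),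
      lintegral_zero_measure]
  · rw [lintegral_gibbsColumn j Ω h0 ht, mul_comm, ← mul_assoc, ENNReal.mul_inv_cancel h0 ht,
      one_mul]

/-! ### Flows of two-stage column updates -/

variable (D) in
/-- The update of column `j` that moves the edge pattern by `L Ω` and then draws the column exactly
given the new pattern. -/
def columnUpdate (j : Fin p) (L : Matrix (Fin p) (Fin p) ℝ → Matrix (Model j) (Model j) ℝ)
    (Ω : Matrix (Fin p) (Fin p) ℝ) : Measure (Matrix (Fin p) (Fin p) ℝ) :=
  ∑ z, ENNReal.ofReal (L Ω (pattern j Ω) z) • D.columnGiven j Ω z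

variable (D) in
/-- The conditional flow out of `A` given `Ω_{-j-j}` of a two-stage update of column `j`. -/
def columnFlow (j : Fin p) (L : Matrix (Fin p) (Fin p) ℝ → Matrix (Model j) (Model j) ℝ)
    (A : Set (Matrix (Fin p) (Fin p) ℝ)) (Ω : Matrix (Fin p) (Fin p) ℝ) : ℝ≥0∞ :=
  ∑ z, ENNReal.ofReal (D.modelProb j Ω z) * (D.columnGiven j Ω z A *
    ∑ z', ENNReal.ofReal (L Ω z z') * D.columnGiven j Ω z' Aᶜ)

variable (D) in
/-- The matrix with all rows equal to `π(z | Y, Ω_{-j-j})`. -/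
def modelProbMatrix (j : Fin p) (Ω : Matrix (Fin p) (Fin p) ℝ) : Matrix (Model j) (Model j) ℝ :=
  fun _ z => D.modelProb j Ω z

theorem columnUpdate_apply (j : Fin p)
    (L : Matrix (Fin p) (Fin p) ℝ → Matrix (Model j) (Model j) ℝ)
    (Ω : Matrix (Fin p) (Fin p) ℝ) (A : Set (Matrix (Fin p) (Fin p) ℝ)) :
    D.columnUpdate j L Ω A =
      ∑ z, ENNReal.ofReal (L Ω (pattern j Ω) z) * D.columnGiven j Ω z A := by
  simp only [columnUpdate, Measure.finsetSum_apply, Measure.smul_apply, smul_eq_mul]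

section

variable {j : Fin p} {L : Matrix (Fin p) (Fin p) ℝ → Matrix (Model j) (Model j) ℝ}
  {A : Set (Matrix (Fin p) (Fin p) ℝ)}

theorem IsRegular.measurable_columnUpdate_apply (hD : D.IsRegular)
    (hL : ∀ z z', Measurable fun Ω => L Ω z z') (hA : MeasurableSet A) :
    Measurable fun Ω => D.columnUpdate j L Ω A := by
  simp only [columnUpdate_apply]
  exact Finset.measurable_sum _ fun z _ =>
    (measurable_pattern_comp j (L := fun Ω z' => L Ω z' z) fun z' => hL z' z).ennreal_ofReal.mul
      (hD.measurable_columnGiven_apply j z hA)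

theorem IsRegular.measurable_columnFlow (hD : D.IsRegular)
    (hL : ∀ z z', Measurable fun Ω => L Ω z z') (hA : MeasurableSet A) :
    Measurable (D.columnFlow j L A) :=
  Finset.measurable_sum _ fun z _ => (hD.measurable_modelProb j z).ennreal_ofReal.mul
    ((hD.measurable_columnGiven_apply j z hA).mul (Finset.measurable_sum _ fun z' _ =>
      (hL z z').ennreal_ofReal.mul (hD.measurable_columnGiven_apply j z' hA.compl)))

/-- The flow of a two-stage column update under the posterior is the average of the conditional
flows. -/
theorem IsRegular.setLIntegral_columnUpdate (hD : D.IsRegular)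
    (hfin : D.posteriorWeight Set.univ ≠ ∞) {a : ℝ≥0∞} (ha : D.posterior = a • D.posteriorWeight)
    (hL : ∀ z z', Measurable fun Ω => L Ω z z')
    (hinv : ∀ Ω v, L (setColumn Ω j v) = L Ω) (hA : MeasurableSet A) :
    ∫⁻ Ω in A, D.columnUpdate j L Ω Aᶜ ∂D.posterior =
      ∫⁻ Ω, D.columnFlow j L A Ω ∂D.posterior := by
  have hF := hD.measurable_columnUpdate_apply hL hA.compl
  rw [← lintegral_indicator hA, ha, lintegral_smul_measure, lintegral_smul_measure,
    -- By invariance the starting point may be redrawn by an exact update. Its pattern then has law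
    -- `modelProb` and, given the pattern `z`, the first stage acts by the fixed row `L Ω z`.
    hD.lintegral_gibbsColumn_posteriorWeight j hfin (hF.indicator hA)]
  congr 1
  refine lintegral_congr fun Ω => ?_
  rw [gibbsColumn, lintegral_finsetSum_measure, columnFlow]
  refine Finset.sum_congr rfl fun z _ => ?_
  rw [lintegral_smul_measure, smul_eq_mul, columnGiven, normalize, lintegral_smul_measure,
    Measure.smul_apply, smul_eq_mul, smul_eq_mul]
  rw [hD.lintegral_columnJoint_congr j Ω z (hF.indicator hA)
    ((measurable_const (a := ∑ z', ENNReal.ofReal (L Ω z z') * D.columnGiven j Ω z' Aᶜ)).indicator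
      hA) fun v hv => by
        simp only [Set.indicator, columnUpdate_apply, hv, hinv, columnGiven_setColumn],
    lintegral_indicator_const hA, mul_assoc, mul_comm (D.columnJoint j Ω z A)]

theorem IsRegular.ae_posterior_columnMass (hD : D.IsRegular) (j : Fin p)
    (hfin : D.posteriorWeight Set.univ ≠ ∞) {a : ℝ≥0∞}
    (ha : D.posterior = a • D.posteriorWeight) :
    ∀ᵐ Ω ∂D.posterior, D.columnMass j Ω ≠ 0 ∧ D.columnMass j Ω ≠ ∞ := by
  rw [ha]
  exact Measure.ae_smul_measure (hD.ae_posteriorWeight_columnMass j hfin) a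

theorem columnGiven_univ_le_one (j : Fin p) (Ω : Matrix (Fin p) (Fin p) ℝ) (z : Model j) :
    D.columnGiven j Ω z Set.univ ≤ 1 := by
  rw [columnGiven, normalize, Measure.smul_apply, smul_eq_mul]
  exact ENNReal.inv_mul_le_one _

theorem columnGiven_real_le_one (j : Fin p) (Ω : Matrix (Fin p) (Fin p) ℝ) (z : Model j)
    (A : Set (Matrix (Fin p) (Fin p) ℝ)) : (D.columnGiven j Ω z).real A ≤ 1 :=
  ENNReal.toReal_le_of_le_ofReal zero_le_one (by
    simpa using (measure_mono (Set.subset_univ A)).trans (columnGiven_univ_le_one j Ω z))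

variable {Ω : Matrix (Fin p) (Fin p) ℝ}

theorem isProbabilityMeasure_columnGiven (ht : D.columnMass j Ω ≠ ∞) {z : Model j}
    (hz : D.modelProb j Ω z ≠ 0) : IsProbabilityMeasure (D.columnGiven j Ω z) := by
  refine ⟨normalize_univ (fun h => hz ?_) (columnJoint_univ_ne_top ht z)⟩
  rw [modelProb, h, ENNReal.zero_div, ENNReal.toReal_zero]

theorem sum_modelProb (h0 : D.columnMass j Ω ≠ 0) (ht : D.columnMass j Ω ≠ ∞) :
    ∑ z, D.modelProb j Ω z = 1 := by
  have h : ∑ z, ENNReal.ofReal (D.modelProb j Ω z) = 1 := by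
    simp only [ofReal_modelProb h0 ht, ENNReal.div_eq_inv_mul, ← Finset.mul_sum]
    exact ENNReal.inv_mul_cancel h0 ht
  rw [← ENNReal.ofReal_sum_of_nonneg fun z _ => D.modelProb_nonneg j Ω z] at h
  simpa using h

theorem isReversibleChain_modelProbMatrix (h0 : D.columnMass j Ω ≠ 0)
    (ht : D.columnMass j Ω ≠ ∞) :
    IsReversibleChain (D.modelProb j Ω) (D.modelProbMatrix j Ω) where
  nonneg _ z := D.modelProb_nonneg j Ω z
  row_sum _ := sum_modelProb h0 ht
  balance _ _ := mul_comm _ _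

/-- The conditional flow in terms of the finite chain on edge patterns. -/
theorem columnFlow_eq (ht : D.columnMass j Ω ≠ ∞)
    (hL : IsReversibleChain (D.modelProb j Ω) (L Ω)) (hA : MeasurableSet A) :
    D.columnFlow j L A Ω = ENNReal.ofReal (∑ z, D.modelProb j Ω z * (D.columnGiven j Ω z).real A *
      ∑ z', L Ω z z' * (1 - (D.columnGiven j Ω z').real A)) := by
  have hf := fun z => sub_nonneg.mpr (columnGiven_real_le_one (D := D) j Ω z A)
  have hS : ∀ z, 0 ≤ ∑ z', L Ω z z' * (1 - (D.columnGiven j Ω z').real A) := fun z =>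
    Finset.sum_nonneg fun z' _ => mul_nonneg (hL.nonneg z z') (hf z')
  rw [columnFlow, ENNReal.ofReal_sum_of_nonneg fun z _ =>
    mul_nonneg (mul_nonneg (D.modelProb_nonneg j Ω z) measureReal_nonneg) (hS z)]
  refine Finset.sum_congr rfl fun z _ => ?_
  by_cases hz : D.modelProb j Ω z = 0
  · simp [hz]
  have := isProbabilityMeasure_columnGiven ht hz
  rw [mul_assoc, ENNReal.ofReal_mul (D.modelProb_nonneg j Ω z),
    ENNReal.ofReal_mul measureReal_nonneg, ofReal_measureReal,
    ENNReal.ofReal_sum_of_nonneg fun z' _ => mul_nonneg (hL.nonneg z z') (hf z')]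
  congr 2
  refine Finset.sum_congr rfl fun z' _ => ?_
  by_cases hzz : L Ω z z' = 0
  · simp [hzz]
  -- `columnGiven` is a probability measure only at patterns of positive probability. Detailed
  -- balance shows that the chain cannot leave these.
  have hz' : D.modelProb j Ω z' ≠ 0 := fun h => by
    have hb := hL.balance z z'
    rw [h, zero_mul] at hb
    exact (mul_ne_zero hz hzz) hb
  have := isProbabilityMeasure_columnGiven ht hz'
  rw [ENNReal.ofReal_mul (hL.nonneg z z'), ← probReal_compl_eq_one_sub hA, ofReal_measureReal]

theorem columnFlow_le_one (h0 : D.columnMass j Ω ≠ 0) (ht : D.columnMass j Ω ≠ ∞)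
    (hL : IsReversibleChain (D.modelProb j Ω) (L Ω)) : D.columnFlow j L A Ω ≤ 1 := by
  have hle : ∀ z A, D.columnGiven j Ω z A ≤ 1 := fun z A =>
    (measure_mono (Set.subset_univ A)).trans (columnGiven_univ_le_one j Ω z)
  have hrow : ∀ z, ∑ z', ENNReal.ofReal (L Ω z z') * D.columnGiven j Ω z' Aᶜ ≤ 1 := fun z => by
    refine (Finset.sum_le_sum fun z' _ => mul_le_of_le_one_right' (hle z' Aᶜ)).trans ?_
    rw [← ENNReal.ofReal_sum_of_nonneg fun z' _ => hL.nonneg z z', hL.row_sum, ENNReal.ofReal_one]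
  refine (Finset.sum_le_sum fun z _ => mul_le_of_le_one_right'
    (mul_le_one' (hle z A) (hrow z))).trans ?_
  rw [← ENNReal.ofReal_sum_of_nonneg fun z _ => D.modelProb_nonneg j Ω z, sum_modelProb h0 ht,
    ENNReal.ofReal_one]

/-- Comparison of the conditional flows of a two-stage update and of the exact update. -/
theorem mul_columnFlow_le (h0 : D.columnMass j Ω ≠ 0) (ht : D.columnMass j Ω ≠ ∞)
    (hL : IsReversibleChain (D.modelProb j Ω) (L Ω)) (hA : MeasurableSet A) {c : ℝ} (hc0 : 0 ≤ c)
    (hc : c ≤ spectralGap (D.modelProb j Ω) (L Ω) / 2) :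
    ENNReal.ofReal c * D.columnFlow j (D.modelProbMatrix j) A Ω ≤ D.columnFlow j L A Ω := by
  have hf := fun z => columnGiven_real_le_one (D := D) j Ω z A
  rw [columnFlow_eq ht hL hA, columnFlow_eq ht (isReversibleChain_modelProbMatrix h0 ht) hA,
    ← ENNReal.ofReal_mul hc0]
  refine ENNReal.ofReal_le_ofReal ((mul_le_mul_of_nonneg_right hc ?_).trans
    (half_spectralGap_mul_flow_le (D.modelProb_nonneg j Ω) (sum_modelProb h0 ht) hL
      (fun z => measureReal_nonneg) hf))
  exact Finset.sum_nonneg fun z _ => mul_nonneg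
    (mul_nonneg (D.modelProb_nonneg j Ω z) measureReal_nonneg)
    (Finset.sum_nonneg fun z' _ => mul_nonneg (D.modelProb_nonneg j Ω z')
      (sub_nonneg.mpr (hf z')))

end

/-- The infimum of the gaps runs over every `Ω` in `B`, including null ones where the full
conditional is undefined. There the target vanishes and the gap takes its default value `1`. -/
theorem modelProb_eq_zero_of_degenerate {j : Fin p} {Ω : Matrix (Fin p) (Fin p) ℝ}
    (h : ¬(D.columnMass j Ω ≠ 0 ∧ D.columnMass j Ω ≠ ∞)) (z : Model j) :
    D.modelProb j Ω z = 0 := by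
  change (D.columnJoint j Ω z Set.univ / D.columnMass j Ω).toReal = 0
  rcases not_and_or.mp h with h | h
  · rw [not_not] at h
    rw [Finset.sum_eq_zero_iff.mp h z (Finset.mem_univ z), ENNReal.zero_div, ENNReal.toReal_zero]
  · rw [not_not] at h
    rw [h, ENNReal.div_top, ENNReal.toReal_zero]

/-! ### Gaps over `B` and the integrated comparison -/

section CondGap

variable {alg : MHAlgorithm} {M : ℕ} {B : Set (Matrix (Fin p) (Fin p) ℝ)}

theorem IsRegular.isReversibleChain_condKernel (hD : D.IsRegular) (halg : alg.IsValid)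
    (M : ℕ) (j : Fin p) (Ω : Matrix (Fin p) (Fin p) ℝ) :
    IsReversibleChain (D.modelProb j Ω) (D.condKernel alg M j Ω) :=
  D.isReversibleChain_condKernel hD.θ_pos hD.θ_lt_one hD.g_pos hD.lam_pos halg M j Ω

theorem IsRegular.condGap_nonneg (hD : D.IsRegular) (halg : alg.IsValid) (j : Fin p)
    (Ω : Matrix (Fin p) (Fin p) ℝ) : 0 ≤ D.condGap alg M j Ω :=
  spectralGap_nonneg (D.modelProb_nonneg j Ω) (hD.isReversibleChain_condKernel halg M j Ω)

theorem IsRegular.condGap_le_two (hD : D.IsRegular) (halg : alg.IsValid) (j : Fin p)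
    (Ω : Matrix (Fin p) (Fin p) ℝ) : D.condGap alg M j Ω ≤ 2 := by
  by_cases h : D.columnMass j Ω ≠ 0 ∧ D.columnMass j Ω ≠ ∞
  · exact spectralGap_le_two (D.modelProb_nonneg j Ω) (sum_modelProb h.1 h.2)
      (hD.isReversibleChain_condKernel halg M j Ω)
  · have h0 : D.modelProb j Ω = 0 := funext (modelProb_eq_zero_of_degenerate h)
    rw [condGap, h0, spectralGap, if_neg]
    · norm_num
    · rintro ⟨f, hf⟩
      simp [variance] at hf

theorem IsRegular.iInf_condGap_nonneg (hD : D.IsRegular) (halg : alg.IsValid) :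
    0 ≤ ⨅ j : Fin p, ⨅ Ω : B, D.condGap alg M j Ω :=
  Real.iInf_nonneg fun j => Real.iInf_nonneg fun Ω => hD.condGap_nonneg halg j Ω

theorem IsRegular.iInf_condGap_le (hD : D.IsRegular) (halg : alg.IsValid) (j : Fin p)
    {Ω : Matrix (Fin p) (Fin p) ℝ} (hΩ : Ω ∈ B) :
    ⨅ j : Fin p, ⨅ Ω : B, D.condGap alg M j Ω ≤ D.condGap alg M j Ω := by
  have h1 : ⨅ j : Fin p, ⨅ Ω : B, D.condGap alg M j Ω ≤ ⨅ Ω : B, D.condGap alg M j Ω := by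
    refine ciInf_le ⟨0, ?_⟩ j
    rintro _ ⟨j, rfl⟩
    exact Real.iInf_nonneg fun Ω => hD.condGap_nonneg halg j Ω
  refine h1.trans (ciInf_le (f := fun Ω : B => D.condGap alg M j Ω) ⟨0, ?_⟩ ⟨Ω, hΩ⟩)
  rintro _ ⟨Ω, rfl⟩
  exact hD.condGap_nonneg halg j Ω

theorem IsRegular.iInf_condGap_le_two (hD : D.IsRegular) (halg : alg.IsValid) (hp : 1 ≤ p) :
    ⨅ j : Fin p, ⨅ Ω : B, D.condGap alg M j Ω ≤ 2 := by
  rcases B.eq_empty_or_nonempty with rfl | ⟨Ω, hΩ⟩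
  -- For empty `B` the real infimum takes its default value `0`.
  · simp
  · exact (hD.iInf_condGap_le halg ⟨0, hp⟩ hΩ).trans (hD.condGap_le_two halg _ Ω)

/-- Integrated comparison of the flows of the two samplers in column `j`. -/
theorem IsRegular.mul_lintegral_columnFlow_le (hD : D.IsRegular) (halg : alg.IsValid) (j : Fin p)
    (hfin : D.posteriorWeight Set.univ ≠ ∞) {a : ℝ≥0∞} (ha : D.posterior = a • D.posteriorWeight)
    {A : Set (Matrix (Fin p) (Fin p) ℝ)} (hA : MeasurableSet A) {c : ℝ} (hc0 : 0 ≤ c)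
    (hc : ∀ Ω ∈ B, c ≤ D.condGap alg M j Ω / 2) :
    ENNReal.ofReal c * ∫⁻ Ω, D.columnFlow j (D.modelProbMatrix j) A Ω ∂D.posterior ≤
      ∫⁻ Ω, D.columnFlow j (D.condKernel alg M j) A Ω ∂D.posterior +
        ENNReal.ofReal c * D.posterior Bᶜ := by
  have hG : Measurable (D.columnFlow j (D.modelProbMatrix j) A) :=
    hD.measurable_columnFlow (fun _ z => hD.measurable_modelProb j z) hA
  have hM : Measurable (D.columnFlow j (D.condKernel alg M j) A) :=
    hD.measurable_columnFlow (hD.measurable_condKernel alg M j) hA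
  have hae := hD.ae_posterior_columnMass j hfin ha
  -- `B` need not be measurable. The failure set `N` of the comparison is measurable and almost
  -- surely contained in `Bᶜ`, so it serves in place of `Bᶜ`.
  set N := {Ω | D.columnFlow j (D.condKernel alg M j) A Ω <
    ENNReal.ofReal c * D.columnFlow j (D.modelProbMatrix j) A Ω}
  have hNm : MeasurableSet N := measurableSet_lt hM (hG.const_mul _)
  have hNB : D.posterior N ≤ D.posterior Bᶜ := by
    refine measure_mono_ae ?_
    filter_upwards [hae] with Ω hΩ hΩN hΩB
    exact (not_lt.mpr (mul_columnFlow_le hΩ.1 hΩ.2 (hD.isReversibleChain_condKernel halg M j Ω) hA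
      hc0 (hc Ω hΩB))) hΩN
  calc ENNReal.ofReal c * ∫⁻ Ω, D.columnFlow j (D.modelProbMatrix j) A Ω ∂D.posterior
      = ∫⁻ Ω, ENNReal.ofReal c * D.columnFlow j (D.modelProbMatrix j) A Ω ∂D.posterior :=
        (lintegral_const_mul _ hG).symm
    _ ≤ ∫⁻ Ω, (D.columnFlow j (D.condKernel alg M j) A Ω +
          N.indicator (fun _ => ENNReal.ofReal c) Ω) ∂D.posterior := by
        refine lintegral_mono_ae ?_
        filter_upwards [hae] with Ω hΩ
        by_cases hΩN : Ω ∈ N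
        · rw [Set.indicator_of_mem hΩN]
          exact (mul_le_of_le_one_right' (columnFlow_le_one hΩ.1 hΩ.2
            (isReversibleChain_modelProbMatrix hΩ.1 hΩ.2))).trans le_add_self
        · rw [Set.indicator_of_notMem hΩN, add_zero]
          exact not_lt.mp hΩN
    _ = ∫⁻ Ω, D.columnFlow j (D.condKernel alg M j) A Ω ∂D.posterior +
          ENNReal.ofReal c * D.posterior N := by
        rw [lintegral_add_left hM, lintegral_indicator_const hNm]
    _ ≤ _ := by gcongr

end CondGap

end Setup

/-! ### Conductance of lazy random-scan samplers -/

/-- Staying put at a point of `A` gives no mass to `Aᶜ`, so the identity part drops out. -/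
theorem setLIntegral_lazyScan {p : ℕ}
    {P : Fin p → Matrix (Fin p) (Fin p) ℝ → Measure (Matrix (Fin p) (Fin p) ℝ)}
    {π : Measure (Matrix (Fin p) (Fin p) ℝ)} {A : Set (Matrix (Fin p) (Fin p) ℝ)}
    (hA : MeasurableSet A) (hP : ∀ j, Measurable fun Ω => P j Ω Aᶜ) :
    ∫⁻ Ω in A, lazyScan P Ω Aᶜ ∂π = (2 * (p : ℝ≥0∞))⁻¹ * ∑ j, ∫⁻ Ω in A, P j Ω Aᶜ ∂π := by
  rw [← lintegral_finsetSum _ fun j _ => hP j,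
    ← lintegral_const_mul _ (Finset.measurable_sum _ fun j _ => hP j)]
  refine setLIntegral_congr_fun hA fun Ω hΩ => ?_
  simp [lazyScan, Measure.dirac_apply' Ω hA.compl, hΩ]

theorem inv_two_mul_mul_sum_le {p : ℕ} (hp : 1 ≤ p) {x : Fin p → ℝ≥0∞} {b : ℝ≥0∞}
    (hx : ∀ j, x j ≤ b) : (2 * (p : ℝ≥0∞))⁻¹ * ∑ j, x j ≤ b := by
  have hp0 : (p : ℝ≥0∞) ≠ 0 := by exact_mod_cast (by omega : p ≠ 0)
  calc (2 * (p : ℝ≥0∞))⁻¹ * ∑ j, x j ≤ (2 * (p : ℝ≥0∞))⁻¹ * ∑ _j : Fin p, b := by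
        gcongr with j; exact hx j
    _ ≤ (p : ℝ≥0∞)⁻¹ * (p * b) := by
        rw [Finset.sum_const, Finset.card_univ, Fintype.card_fin, nsmul_eq_mul]
        gcongr
        exact le_mul_of_one_le_left' (by norm_num)
    _ = b := by
        rw [← mul_assoc, ENNReal.inv_mul_cancel hp0 (ENNReal.natCast_ne_top p), one_mul]

theorem sConductance_zero {α : Type*} [MeasurableSpace α] (P : α → Measure α) {s : ℝ}
    (hs : 0 < s) : sConductance (0 : Measure α) P s = 0 := by
  rw [sConductance]
  convert Real.sInf_empty
  rw [Set.eq_empty_iff_forall_notMem]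
  rintro r ⟨S, -, h, -⟩
  simp at h
  linarith

theorem sConductance_le {α : Type*} [MeasurableSpace α] {π : Measure α} {P : α → Measure α}
    {s : ℝ} {A : Set α} (hA : MeasurableSet A) (h1 : s < π.real A) (h2 : π.real A < 1 / 2) :
    sConductance π P s ≤ (∫⁻ x in A, P x Aᶜ ∂π).toReal / π.real A := by
  refine csInf_le ⟨0, ?_⟩ ⟨A, hA, h1, h2, rfl⟩
  rintro r ⟨S, -, -, -, rfl⟩
  positivity

end GGM

end

/-! ### The conductance bound -/

theorem mainTheorem3 {n p : ℕ} (hp : 1 ≤ p) (D : GGM.Setup n p)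
    (hθ0 : 0 < D.θ) (hθ1 : D.θ < 1) (hg : 0 < D.g) (hlam : 0 < D.lam)
    (alg : GGM.MHAlgorithm) (halg : alg.IsValid) (M : ℕ) (hM : 1 ≤ M)
    (B : Set (Matrix (Fin p) (Fin p) ℝ)) (hB : B ⊆ GGM.posDefSet p)
    (s : ℝ) (hs : 0 < s) :
    1 / 2 * GGM.sConductance D.posterior D.lazyGibbs s *
        (⨅ j : Fin p, ⨅ Ω : B, D.condGap alg M j Ω) - D.posterior.real Bᶜ / s ≤
      GGM.sConductance D.posterior (D.lazyMH alg M) s := by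
  have hD : D.IsRegular := ⟨hθ0, hθ1, hg, hlam⟩
  rcases hD.posterior_eq_zero_or with h0 | ⟨hprob, hfin, a, ha⟩
  -- A posterior that cannot be normalised is the zero measure. It has no test sets, so both
  -- conductances are infima over the empty set, that is `0`.
  · rw [h0, GGM.sConductance_zero _ hs, GGM.sConductance_zero _ hs]
    simp
  set γ := ⨅ j : Fin p, ⨅ Ω : B, D.condGap alg M j Ω
  have hγ0 : 0 ≤ γ := hD.iInf_condGap_nonneg halg
  have hγ2 : γ ≤ 2 := hD.iInf_condGap_le_two halg hp
  have hβ : 0 ≤ D.posterior.real Bᶜ / s := div_nonneg measureReal_nonneg hs.le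
  rcases Set.eq_empty_or_nonempty {r : ℝ | ∃ S : Set (Matrix (Fin p) (Fin p) ℝ), MeasurableSet S ∧
      s < D.posterior.real S ∧ D.posterior.real S < 1 / 2 ∧
      r = (∫⁻ x in S, D.lazyMH alg M x Sᶜ ∂D.posterior).toReal / D.posterior.real S} with he | hne
  -- Whether test sets exist does not depend on the kernel. Without any, both conductances are `0`
  -- and the left side is nonpositive.
  · have hno : ∀ P, GGM.sConductance D.posterior P s = 0 := fun P => by
      rw [GGM.sConductance]
      convert Real.sInf_empty
      rw [Set.eq_empty_iff_forall_notMem] at he ⊢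
      rintro r ⟨S, h1, h2, h3, -⟩
      exact he _ ⟨S, h1, h2, h3, rfl⟩
    rw [hno, hno]
    linarith
  rw [GGM.sConductance.eq_1 D.posterior (D.lazyMH alg M)]
  refine le_csInf hne ?_
  rintro r ⟨A, hA, hsA, hA2, rfl⟩
  have hφ := GGM.sConductance_le (P := D.lazyGibbs) hA hsA hA2
  have hGm : ∀ j, Measurable fun Ω => D.gibbsColumn j Ω Aᶜ := fun j =>
    hD.measurable_columnUpdate_apply (L := D.modelProbMatrix j)
      (fun _ z => hD.measurable_modelProb j z) hA.compl
  have hMm : ∀ j, Measurable fun Ω => D.mhColumn alg M j Ω Aᶜ := fun j =>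
    hD.measurable_columnUpdate_apply (hD.measurable_condKernel alg M j) hA.compl
  have hGf : ∀ j, ∫⁻ Ω in A, D.gibbsColumn j Ω Aᶜ ∂D.posterior =
      ∫⁻ Ω, D.columnFlow j (D.modelProbMatrix j) A Ω ∂D.posterior := fun j =>
    hD.setLIntegral_columnUpdate (L := D.modelProbMatrix j) hfin ha
      (fun _ z => hD.measurable_modelProb j z)
      (fun Ω v => by unfold GGM.Setup.modelProbMatrix; rw [GGM.Setup.modelProb_setColumn]) hA
  have hMf : ∀ j, ∫⁻ Ω in A, D.mhColumn alg M j Ω Aᶜ ∂D.posterior =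
      ∫⁻ Ω, D.columnFlow j (D.condKernel alg M j) A Ω ∂D.posterior := fun j =>
    hD.setLIntegral_columnUpdate hfin ha (hD.measurable_condKernel alg M j)
      (GGM.Setup.condKernel_setColumn alg M j) hA
  have hM1 : ∀ j, ∫⁻ Ω, D.columnFlow j (D.condKernel alg M j) A Ω ∂D.posterior ≤ 1 := fun j => by
    refine (lintegral_mono_ae (g := 1) ?_).trans (by simp)
    filter_upwards [hD.ae_posterior_columnMass j hfin ha] with Ω h
    exact GGM.Setup.columnFlow_le_one h.1 h.2 (hD.isReversibleChain_condKernel halg M j Ω)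
  have hXG := GGM.setLIntegral_lazyScan (π := D.posterior) hA hGm
  have hXM := GGM.setLIntegral_lazyScan (π := D.posterior) hA hMm
  simp only [hGf] at hXG
  simp only [hMf] at hXM
  change ∫⁻ Ω in A, D.lazyGibbs Ω Aᶜ ∂D.posterior = _ at hXG
  change ∫⁻ Ω in A, D.lazyMH alg M Ω Aᶜ ∂D.posterior = _ at hXM
  set XG := ∫⁻ Ω in A, D.lazyGibbs Ω Aᶜ ∂D.posterior
  set XM := ∫⁻ Ω in A, D.lazyMH alg M Ω Aᶜ ∂D.posterior
  -- Needed for the passage to real numbers: `toReal` is monotone only below a finite bound.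
  have hXMt : XM ≠ ⊤ := ne_top_of_le_ne_top ENNReal.one_ne_top
    (hXM ▸ GGM.inv_two_mul_mul_sum_le hp hM1)
  have hcmp : ENNReal.ofReal (γ / 2) * XG ≤ XM + ENNReal.ofReal (γ / 2) * D.posterior Bᶜ := by
    rw [hXG, hXM, mul_left_comm, Finset.mul_sum]
    refine (mul_le_mul_right (Finset.sum_le_sum fun j _ => hD.mul_lintegral_columnFlow_le
      (B := B) (M := M) halg j hfin ha hA (by linarith) fun Ω hΩ => ?_) _).trans ?_
    · have := hD.iInf_condGap_le (M := M) halg j hΩ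
      linarith
    · rw [Finset.sum_add_distrib, mul_add]
      exact add_le_add le_rfl (GGM.inv_two_mul_mul_sum_le hp fun _ => le_rfl)
  have hreal : γ / 2 * XG.toReal ≤ XM.toReal + γ / 2 * D.posterior.real Bᶜ := by
    have hβt : ENNReal.ofReal (γ / 2) * D.posterior Bᶜ ≠ ⊤ :=
      ENNReal.mul_ne_top ENNReal.ofReal_ne_top (measure_ne_top _ _)
    have h := ENNReal.toReal_mono (ENNReal.add_ne_top.mpr ⟨hXMt, hβt⟩) hcmp
    rwa [ENNReal.toReal_add hXMt hβt, ENNReal.toReal_mul, ENNReal.toReal_mul,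
      ENNReal.toReal_ofReal (by linarith)] at h
  have hA0 : 0 < D.posterior.real A := hs.trans hsA
  have h1 : γ / 2 * GGM.sConductance D.posterior D.lazyGibbs s ≤
      γ / 2 * (XG.toReal / D.posterior.real A) := mul_le_mul_of_nonneg_left hφ (by linarith)
  have h2 : γ / 2 * (XG.toReal / D.posterior.real A) ≤
      XM.toReal / D.posterior.real A + γ / 2 * (D.posterior.real Bᶜ / D.posterior.real A) := by
    rw [← mul_div_assoc, ← mul_div_assoc, ← add_div]
    gcongr
  -- The error loses its factor because `γ ≤ 2`, and `π(A) > s` replaces the denominator.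
  have h3 : γ / 2 * (D.posterior.real Bᶜ / D.posterior.real A) ≤ D.posterior.real Bᶜ / s := by
    refine (mul_le_of_le_one_left (by positivity) (by linarith)).trans ?_
    gcongr
  linarith
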